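/- Fix $n\ge 0$, a path-connected pointed space $X$ and a commutative ring $R$; $\mathrm{Mod}(R)$ is the symmetric monoidal category of finitely generated free $R$-modules. Composition is written in diagrammatic order. **$X$-manifolds.** An $X$-manifold $(M,g)$ is a closed oriented smooth $n$-manifold $M$ with exactly one base point in each component and a continuous map $g:M\to X$ sending the base points to the base point of $X$. An $X$-diffeomorphism $(M,g)\to(N,h)$ is an orientation preserving diffeomorphism $\psi$ preserving base points with $h\circ\psi=g$. These form the category $\mathrm{Diff}(n,X)$, symmetric monoidal under disjoint union, with structural isomorphisms $\alpha,\ell,r,\sigma$ and unit $\emptyset$. **$X$-cobordisms.** An $X$-cobordism $(W,F):(M,g)\to(N,h)$ is a compact oriented smooth $(n+1)$-manifold $W$ with $\partial W\cong(-M)\amalg N$, together with a homotopy class, relative to $\partial W$, of maps $F:W\to X$ restricting to $g$ and $h$ on the boundary. The identity cobordism $1_{(M,g)}$ is $I\times M$ with the map $(t,x)\mapsto g(x)$. A gluing of $W:(M,g)\to(N,h)$ and $V:(N',h')\to(P,j)$ along an $X$-diffeomorphism $\psi:(N,h)\to(N',h')$ is an $X$-cobordism $Q:(M,g)\to(P,j)$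 that is the union of smoothly embedded oriented copies of $W$ and $V$ meeting exactly in the outgoing boundary of $W$, identified by $\psi$ with the incoming boundary of $V$, with homotopy class obtained by gluing representatives; one writes $Q=W\amalg_\psi V$ for any such $Q$ (it is unique up to $X$-diffeomorphism relative to the boundary). An $X$-diffeomorphism $\Psi:(W,F)\to(V,G)$ of $X$-cobordisms is an orientation preserving diffeomorphism restricting to $X$-diffeomorphisms $\Psi_-$, $\Psi_+$ of the incoming and outgoing boundaries, with $[G\circ\Psi]=[F]$. **HQFTs.** For a symmetric monoidal category $\mathcal D$, such as $\mathrm{Mod}(R)$, an $n$-dimensional HQFT $\tau$ with target $X$ and values in $\mathcal D$ consists of a symmetric monoidal functor $\tau:\mathrm{Diff}(n,X)\to\mathcal D$, with structural isomorphisms $c:\tau(A\amalg B)\cong\tau(A)\otimes\tau(B)$ and $u:\tau(\emptyset)\cong \mathbf 1$ (for $\mathrm{Mod}(R)$, $\mathbf 1=R$), and a morphism $\tau(W):\tau(A)\to\tau(B)$ for every $X$-cobordism $W:A\to B$, such that: 1. $\tau(W\amalg_\psi V)=\tau(W)\tau(\psi)\tau(V)$ for every gluing; 2. $\tau(1_{(M,g)})=1_{\tau(M,g)}$;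 3. $c$ is natural for cobordisms, i.e. $\tau(W\amalg V)\,c=c\,(\tau(W)\otimes\tau(V))$, and the empty $X$-cobordism $P:\emptyset\to\emptyset$ satisfies $\tau(P)\,u=u$; 4. $\tau(W)\tau(\Psi_+)=\tau(\Psi_-)\tau(V)$ for every $X$-diffeomorphism $\Psi:W\to V$ of $X$-cobordisms. A map $\tau\to\rho$ of HQFTs is a family $\theta_A:\tau(A)\to\rho(A)$ natural for $X$-diffeomorphisms and $X$-cobordisms and compatible with $c$ and $u$. HQFTs with values in $\mathrm{Mod}(R)$ and their maps form the category $\mathrm{HQFT}(n,X)$. **The homotopy cobordism category.** $\mathrm{HCobord}(n,X)$ has the $X$-manifolds as objects. Its morphisms are the non-empty composable strings of $X$-diffeomorphisms and $X$-cobordisms (the free category without units on them), modulo the congruence compatible with disjoint union with objects on either side (where the disjoint union of a cobordism with an object $P$ is the one with $1_P$) that is generated by the following relations: - $\langle\psi\rangle\langle\phi\rangle\sim\langle\psi\phi\rangle$, $\ \langle W\rangle\langle V\rangle\sim\langle Q\rangle$ for every gluing $Q$ of $W$ and $V$ along the identity, $\ \langle 1_{(M,g)}\rangle\sim\langle \mathrm{id}_{(M,g)}\rangle$;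 - disjoint union is a bifunctor: $(a\amalg A')(B\amalg b)\sim(A\amalg b)(a\amalg B')$ for $X$-diffeomorphisms or $X$-cobordisms $a:A\to B$, $b:A'\to B'$, and $W\amalg V\sim(W\amalg A')(B\amalg V)$ for $X$-cobordisms $W:A\to B$, $V:A'\to B'$; - $\alpha$, $\ell$, $r$ and $\sigma$ are natural for $X$-cobordisms; - $\langle W\rangle\langle\Psi_+\rangle\sim\langle\Psi_-\rangle\langle V\rangle$ for every $X$-diffeomorphism $\Psi:W\to V$ of $X$-cobordisms; - $\langle W\rangle\langle\psi\rangle\langle V\rangle\sim\langle Q\rangle$ for every gluing $Q$ of $W$ and $V$ along $\psi$; - $\langle V\rangle\langle 1_{(M,g)}\rangle\sim\langle V\rangle$ and $\langle 1_{(M,g)}\rangle\langle W\rangle\sim\langle W\rangle$. It is symmetric monoidal under disjoint union. A continuous pointed map $f:X\to Y$ induces a symmetric monoidal functor $f_*:\mathrm{HCobord}(n,X)\to\mathrm{HCobord}(n,Y)$, and a functor $f^*:\mathrm{HQFT}(n,Y)\to\mathrm{HQFT}(n,X)$, by composing characteristic maps and homotopy classes with $f$. Let $[\mathcal A,\mathcal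 B]$ be the category of symmetric monoidal functors and monoidal natural transformations. **Theorem.** There are functors $$\Phi_{X,R}:\mathrm{HQFT}(n,X)\longrightarrow[\mathrm{HCobord}(n,X),\mathrm{Mod}(R)],$$ for all $X$ and $R$, such that each $\Phi_{X,R}$ is an isomorphism of categories, whose inverse is the restriction of a symmetric monoidal functor to $X$-manifolds, $X$-diffeomorphisms and $X$-cobordisms. The isomorphism is natural: for every pointed map $f:X\to Y$, $\Phi_{X,R}\circ f^*=(-\circ f_*)\circ\Phi_{Y,R}$, and for every symmetric monoidal functor $T:\mathrm{Mod}(R)\to\mathrm{Mod}(S)$, $\Phi_{X,S}\circ(T\circ-)=(T\circ-)\circ\Phi_{X,R}$. -/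

import Mathlib

open CategoryTheory MonoidalCategory Topology

universe u v

noncomputable section

set_option linter.unusedSectionVars false

namespace HQFTs

section Orientation

open scoped Manifold ContDiff

variable {E H : Type} [NormedAddCommGroup E] [NormedSpace ℝ E] [TopologicalSpace H]
  {E' H' : Type} [NormedAddCommGroup E'] [NormedSpace ℝ E'] [TopologicalSpace H']
  (I : ModelWithCorners ℝ E H) (I' : ModelWithCorners ℝ E' H')

/-- An orientation of a smooth manifold `M` modelled on `E`. The tangent space at `x` is `E`, seen
in the preferred chart at `x`; the sign of `x` says whether the chosen orientation of it is a fixed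
standard orientation of `E` or the opposite one. The choice is continuous: read in the preferred
chart at `x₀`, the orientations at the points near `x₀` agree with the one at `x₀`. (The definition
covers dimension zero, where an orientation is a sign for every point.) -/
structure Orient (M : Type) [TopologicalSpace M] [ChartedSpace H M] [IsManifold I ∞ M] where
  sign : M → ℤˣ
  coherent : ∀ x₀, ∀ᶠ x in 𝓝 x₀,
    0 < (sign x * sign x₀) • (tangentCoordChange I x x₀ x).det

variable {M N P M' N' : Type} [TopologicalSpace M] [ChartedSpace H M] [IsManifold I ∞ M]
  [TopologicalSpace N] [ChartedSpace H N] [IsManifold I ∞ N]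
  [TopologicalSpace P] [ChartedSpace H P] [IsManifold I ∞ P]
  [TopologicalSpace M'] [ChartedSpace H' M'] [IsManifold I' ∞ M']
  [TopologicalSpace N'] [ChartedSpace H' N'] [IsManifold I' ∞ N']

/-- The differential of a map at a point, as a linear map between the model spaces (by means of the
preferred charts at the point and at its image). -/
def dAt (f : M → M') (x : M) : E →L[ℝ] E' := mfderiv I I' f x

variable {I} in
/-- A map between manifolds of the same dimension is a local diffeomorphism to first order and
preserves the orientation, at every point. -/
def Preserves (o : Orient I M) (o' : Orient I N) (f : M → N) : Prop :=
  ∀ x, 0 < (o.sign x * o'.sign (f x)) • (dAt I I f x).det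

theorem det_comp_mul (A B : E →L[ℝ] E) : (A.comp B).det = B.det * A.det :=
  (LinearMap.det_comp _ _).trans (mul_comm _ _)

theorem smul_pos_mul {a b c : ℤˣ} {d e : ℝ} (h : 0 < (a * b) • d) (h' : 0 < (b * c) • e) :
    0 < (a * c) • (d * e) := by
  rcases Int.units_eq_one_or a with rfl | rfl <;> rcases Int.units_eq_one_or b with rfl | rfl <;>
  rcases Int.units_eq_one_or c with rfl | rfl <;> simp [Units.smul_def] at * <;> nlinarith

theorem smul_pos_cancel {a b c : ℤˣ} {d e : ℝ} (h : 0 < (a * b) • d)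
    (h' : 0 < (a * c) • (d * e)) : 0 < (b * c) • e := by
  rcases Int.units_eq_one_or a with rfl | rfl <;> rcases Int.units_eq_one_or b with rfl | rfl <;>
  rcases Int.units_eq_one_or c with rfl | rfl <;> simp [Units.smul_def] at * <;> nlinarith

variable {I I'}

theorem dAt_id (x : M) : dAt I I (id : M → M) x = ContinuousLinearMap.id ℝ E := mfderiv_id

theorem dAt_comp {E'' H'' : Type} [NormedAddCommGroup E''] [NormedSpace ℝ E'']
    [TopologicalSpace H''] {I'' : ModelWithCorners ℝ E'' H''}
    {Q : Type} [TopologicalSpace Q] [ChartedSpace H'' Q] [IsManifold I'' ∞ Q]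
    {f : M → M'} {g : M' → Q} (hg : ContMDiff I' I'' ∞ g)
    (hf : ContMDiff I I' ∞ f) (x : M) :
    dAt I I'' (g ∘ f) x = (dAt I' I'' g (f x)).comp (dAt I I' f x) :=
  mfderiv_comp x (hg.mdifferentiable (by simp) _) (hf.mdifferentiable (by simp) _)

theorem dAt_inl (x : M) : dAt I I (Sum.inl : M → M ⊕ N) x = ContinuousLinearMap.id ℝ E := by
  refine HasMFDerivAt.mfderiv ⟨continuous_inl.continuousAt, ?_⟩
  apply (hasFDerivWithinAt_id _ _).congr_of_eventuallyEq
  · set C := chartAt H x with hC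
    have : I.symm ⁻¹' C.target ∩ Set.range I ∈ 𝓝[Set.range I] (extChartAt I x) x := by
      rw [← I.image_eq (chartAt H x).target]
      exact (chartAt H x).extend_image_target_mem_nhds (mem_chart_source _ x)
    filter_upwards [this] with y hy
    simp [writtenInExtChartAt, extChartAt, ← hC, C.right_inv hy.1, I.right_inv hy.2]
  · simp [writtenInExtChartAt]

theorem dAt_inr (x : N) : dAt I I (Sum.inr : N → M ⊕ N) x = ContinuousLinearMap.id ℝ E := by
  refine HasMFDerivAt.mfderiv ⟨continuous_inr.continuousAt, ?_⟩
  apply (hasFDerivWithinAt_id _ _).congr_of_eventuallyEq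
  · set C := chartAt H x with hC
    have : I.symm ⁻¹' C.target ∩ Set.range I ∈ 𝓝[Set.range I] (extChartAt I x) x := by
      rw [← I.image_eq (chartAt H x).target]
      exact (chartAt H x).extend_image_target_mem_nhds (mem_chart_source _ x)
    filter_upwards [this] with y hy
    simp [writtenInExtChartAt, extChartAt, ← hC, C.right_inv hy.1, I.right_inv hy.2]
  · simp [writtenInExtChartAt]

theorem Preserves.id (o : Orient I M) : Preserves o o id := fun x => by
  simp [dAt_id, ContinuousLinearMap.det]

theorem Preserves.comp {o : Orient I M} {o' : Orient I N} {o'' : Orient I P} {f : M → N}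
    {g : N → P} (hg : Preserves o' o'' g) (hf : Preserves o o' f) (cg : ContMDiff I I ∞ g)
    (cf : ContMDiff I I ∞ f) : Preserves o o'' (g ∘ f) := fun x => by
  rw [dAt_comp cg cf, det_comp_mul]
  exact smul_pos_mul (hf x) (hg (f x))

theorem Preserves.symm {o : Orient I M} {o' : Orient I N} {f : Diffeomorph I I M N ∞}
    (hf : Preserves o o' f) : Preserves o' o f.symm := fun y => by
  have h := Preserves.id o (f.symm y)
  have e : (_root_.id : M → M) = f.symm ∘ f := by ext; simp
  rw [e, dAt_comp f.symm.contMDiff f.contMDiff, det_comp_mul] at h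
  have := smul_pos_cancel (hf (f.symm y)) h
  simpa using this

theorem tangentCoordChange_inl (x y : M) :
    tangentCoordChange I (Sum.inl y : M ⊕ N) (Sum.inl x) (Sum.inl y) =
      tangentCoordChange I y x y := by
  have : extChartAt I (Sum.inl x : M ⊕ N) ∘ (extChartAt I (Sum.inl y : M ⊕ N)).symm
      = extChartAt I x ∘ (extChartAt I y).symm := by
    ext z
    simp [extChartAt, ChartedSpace.sum_chartAt_inl (M' := N) y]
  rw [tangentCoordChange_def, tangentCoordChange_def, this, extChartAt_inl_apply]

theorem tangentCoordChange_inr (x y : N) :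
    tangentCoordChange I (Sum.inr y : M ⊕ N) (Sum.inr x) (Sum.inr y) =
      tangentCoordChange I y x y := by
  have : extChartAt I (Sum.inr x : M ⊕ N) ∘ (extChartAt I (Sum.inr y : M ⊕ N)).symm
      = extChartAt I x ∘ (extChartAt I y).symm := by
    ext z
    simp [extChartAt, ChartedSpace.sum_chartAt_inr (M := M) y]
  rw [tangentCoordChange_def, tangentCoordChange_def, this, extChartAt_inr_apply]

/-- The disjoint union of two orientations. -/
def Orient.sum (o : Orient I M) (o' : Orient I N) : Orient I (M ⊕ N) where
  sign := Sum.elim o.sign o'.sign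
  coherent := by
    rintro (x | x)
    · rw [nhds_inl, Filter.eventually_map]
      filter_upwards [o.coherent x] with y hy
      rw [tangentCoordChange_inl]
      exact hy
    · rw [nhds_inr, Filter.eventually_map]
      filter_upwards [o'.coherent x] with y hy
      rw [tangentCoordChange_inr]
      exact hy

theorem Preserves.inl (o : Orient I M) (o' : Orient I N) : Preserves o (o.sum o') Sum.inl :=
  fun x => by simp [Orient.sum, dAt_inl, ContinuousLinearMap.det]

theorem Preserves.inr (o : Orient I M) (o' : Orient I N) : Preserves o' (o.sum o') Sum.inr :=
  fun x => by simp [Orient.sum, dAt_inr, ContinuousLinearMap.det]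

theorem Preserves.ofSum {o : Orient I M} {o' : Orient I N} {o'' : Orient I P} {f : M ⊕ N → P}
    (cf : ContMDiff I I ∞ f) (hl : Preserves o o'' (f ∘ Sum.inl))
    (hr : Preserves o' o'' (f ∘ Sum.inr)) : Preserves (o.sum o') o'' f := by
  rintro (x | x)
  · have := hl x
    rw [dAt_comp cf .inl, dAt_inl] at this
    exact this
  · have := hr x
    rw [dAt_comp cf .inr, dAt_inr] at this
    exact this

theorem dAt_sumMap_inl {Q : Type} [TopologicalSpace Q] [ChartedSpace H' Q] [IsManifold I' ∞ Q]
    {f : M → M'} {g : N → Q} (hf : ContMDiff I I' ∞ f) (hg : ContMDiff I I' ∞ g)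
    (x : M) : dAt I I' (Sum.map f g) (Sum.inl x) = dAt I I' f x := by
  have h := dAt_comp (hf.sumMap hg) ContMDiff.inl x
  have e : Sum.map f g ∘ Sum.inl = Sum.inl ∘ f := rfl
  rw [e, dAt_comp ContMDiff.inl hf x] at h
  simpa [dAt_inl] using h.symm

theorem dAt_sumMap_inr {Q : Type} [TopologicalSpace Q] [ChartedSpace H' Q] [IsManifold I' ∞ Q]
    {f : M → M'} {g : N → Q} (hf : ContMDiff I I' ∞ f) (hg : ContMDiff I I' ∞ g)
    (x : N) : dAt I I' (Sum.map f g) (Sum.inr x) = dAt I I' g x := by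
  have h := dAt_comp (hf.sumMap hg) ContMDiff.inr x
  have e : Sum.map f g ∘ Sum.inr = Sum.inr ∘ g := rfl
  rw [e, dAt_comp ContMDiff.inr hg x] at h
  simpa [dAt_inr] using h.symm

theorem Preserves.sumMap {N₁ P₁ : Type} [TopologicalSpace N₁] [ChartedSpace H N₁]
    [IsManifold I ∞ N₁] [TopologicalSpace P₁] [ChartedSpace H P₁] [IsManifold I ∞ P₁]
    {o : Orient I M} {o' : Orient I N} {u : Orient I N₁} {u' : Orient I P₁}
    {f : M → N₁} {g : N → P₁} (cf : ContMDiff I I ∞ f) (cg : ContMDiff I I ∞ g)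
    (hf : Preserves o u f) (hg : Preserves o' u' g) :
    Preserves (o.sum o') (u.sum u') (Sum.map f g) :=
  .ofSum (cf.sumMap cg) (.comp (f := f) (g := Sum.inl) (.inl u u') hf .inl cf)
    (.comp (f := g) (g := Sum.inr) (.inr u u') hg .inr cg)

theorem Preserves.sumAssoc (o : Orient I M) (o' : Orient I N) (o'' : Orient I P) :
    Preserves ((o.sum o').sum o'') (o.sum (o'.sum o'')) (Diffeomorph.sumAssoc I M ∞ N P) := by
  refine .ofSum (Diffeomorph.contMDiff _)
    (.ofSum ((Diffeomorph.contMDiff _).comp .inl) (.inl _ _) ?_) ?_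
  · exact .comp (f := Sum.inl) (g := Sum.inr) (.inr _ _) (.inl _ _) .inr .inl
  · exact .comp (f := Sum.inr) (g := Sum.inr) (.inr _ _) (.inr _ _) .inr .inr

end Orientation

section Product

open scoped Manifold ContDiff

variable {E H : Type} [NormedAddCommGroup E] [NormedSpace ℝ E] [TopologicalSpace H]
  {E' H' : Type} [NormedAddCommGroup E'] [NormedSpace ℝ E'] [TopologicalSpace H']
  [FiniteDimensional ℝ E] [FiniteDimensional ℝ E']
  {I : ModelWithCorners ℝ E H} {I' : ModelWithCorners ℝ E' H'}
  {M N : Type} [TopologicalSpace M] [ChartedSpace H M] [IsManifold I ∞ M]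
  [TopologicalSpace N] [ChartedSpace H' N] [IsManifold I' ∞ N]

theorem tangentCoordChange_prod {a b z : M × N} (h₁ : z.1 ∈ (extChartAt I a.1).source)
    (h₁' : z.1 ∈ (extChartAt I b.1).source) (h₂ : z.2 ∈ (extChartAt I' a.2).source)
    (h₂' : z.2 ∈ (extChartAt I' b.2).source) :
    tangentCoordChange (I.prod I') a b z =
      (tangentCoordChange I a.1 b.1 z.1).prodMap (tangentCoordChange I' a.2 b.2 z.2) := by
  have g₁ := hasFDerivWithinAt_tangentCoordChange (I := I) ⟨h₁, h₁'⟩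
  have g₂ := hasFDerivWithinAt_tangentCoordChange (I := I') ⟨h₂, h₂'⟩
  have h : HasFDerivWithinAt
      (Prod.map (extChartAt I b.1 ∘ (extChartAt I a.1).symm)
        (extChartAt I' b.2 ∘ (extChartAt I' a.2).symm))
      ((tangentCoordChange I a.1 b.1 z.1).prodMap (tangentCoordChange I' a.2 b.2 z.2))
      (Set.range I ×ˢ Set.range I') (extChartAt I a.1 z.1, extChartAt I' a.2 z.2) :=
    HasFDerivWithinAt.prodMap _ (g₁.mono (Set.fst_image_prod_subset _ _))
      (g₂.mono (Set.snd_image_prod_subset _ _))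
  have e : extChartAt (I.prod I') b ∘ (extChartAt (I.prod I') a).symm =
      Prod.map (extChartAt I b.1 ∘ (extChartAt I a.1).symm)
        (extChartAt I' b.2 ∘ (extChartAt I' a.2).symm) := by
    rw [extChartAt_prod, extChartAt_prod]; rfl
  have e' : extChartAt (I.prod I') a z = (extChartAt I a.1 z.1, extChartAt I' a.2 z.2) := by
    rw [extChartAt_prod]; rfl
  have hu : UniqueDiffWithinAt ℝ (Set.range (I.prod I')) (extChartAt (I.prod I') a z) :=
    (I.prod I').uniqueDiffWithinAt_image
  rw [tangentCoordChange_def, e]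
  rw [e', I.range_prod] at *
  exact h.fderivWithin hu

/-- The product orientation (a standard orientation of the first factor followed by one of the
second is the standard orientation of the product). -/
def Orient.prod (o : Orient I M) (o' : Orient I' N) : Orient (I.prod I') (M × N) where
  sign p := o.sign p.1 * o'.sign p.2
  coherent := by
    rintro ⟨x, y⟩
    rw [nhds_prod_eq]
    filter_upwards [((o.coherent x).and (extChartAt_source_mem_nhds (I := I) x)).prod_mk
      ((o'.coherent y).and (extChartAt_source_mem_nhds (I := I') y))] with p hp
    rw [tangentCoordChange_prod (z := p) (a := p) (b := (x, y)) (mem_extChartAt_source _) hp.1.2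
      (mem_extChartAt_source _) hp.2.2]
    have : ((tangentCoordChange I p.1 x p.1).prodMap (tangentCoordChange I' p.2 y p.2)).det
        = (tangentCoordChange I p.1 x p.1).det * (tangentCoordChange I' p.2 y p.2).det := by
      simp only [ContinuousLinearMap.det]
      exact LinearMap.det_prodMap _ _
    rw [this]
    have h1 := hp.1.1
    have h2 := hp.2.1
    simp only [Units.smul_def, zsmul_eq_mul, Units.val_mul, Int.cast_mul] at h1 h2 ⊢
    calc (0:ℝ) < _ := mul_pos h1 h2
      _ = _ := by ring

/-- The standard orientation of the unit interval. Its preferred charts are `t ↦ t` at the points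
`t < 1` and `t ↦ 1 - t` at the point `1`. -/
def Orient.interval : Orient (𝓡∂ 1) (Set.Icc (0 : ℝ) 1) where
  sign t := if (t : ℝ) < 1 then 1 else -1
  coherent := by
    intro x
    have key : ∀ y z : Set.Icc (0 : ℝ) 1, chartAt (EuclideanHalfSpace 1) z =
        chartAt (EuclideanHalfSpace 1) y → (tangentCoordChange (𝓡∂ 1) y z y).det = 1 := by
      intro y z h
      have : tangentCoordChange (𝓡∂ 1) y z y = ContinuousLinearMap.id ℝ _ := by
        ext1 v
        have h2 : tangentCoordChange (𝓡∂ 1) y z y = tangentCoordChange (𝓡∂ 1) y y y := by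
          rw [tangentCoordChange_def, tangentCoordChange_def]
          unfold extChartAt
          rw [h]
        rw [h2, tangentCoordChange_self (mem_extChartAt_source _)]; rfl
      rw [this]; simp [ContinuousLinearMap.det]
    by_cases hx : (x : ℝ) < 1
    · filter_upwards [(isOpen_lt continuous_subtype_val continuous_const).mem_nhds hx] with y hy
      have hy : (y : ℝ) < 1 := hy
      rw [key y x (by simp [Icc_chartedSpaceChartAt, hx, hy])]
      simp [hx, hy]
    · have hx0 : (0 : ℝ) < x := by linarith
      filter_upwards [(isOpen_lt continuous_const continuous_subtype_val).mem_nhds hx0] with y hy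
      have hy : (0 : ℝ) < y := hy
      by_cases hy' : (y : ℝ) < 1
      · have h : tangentCoordChange (𝓡∂ 1) y x y = -ContinuousLinearMap.id ℝ _ := by
          rw [tangentCoordChange_def]
          refine HasFDerivWithinAt.fderivWithin ?_ (𝓡∂ 1).uniqueDiffWithinAt_image
          have h1 : HasFDerivAt (fun w : EuclideanSpace ℝ (Fin 1) => WithLp.toLp 2 (fun _ => 1) - w)
            (-ContinuousLinearMap.id ℝ _) (extChartAt (𝓡∂ 1) y y) :=
            (hasFDerivAt_id _).const_sub _
          have h2 : (extChartAt (𝓡∂ 1) x ∘ (extChartAt (𝓡∂ 1) y).symm)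
              =ᶠ[𝓝[Set.range (𝓡∂ 1)] (extChartAt (𝓡∂ 1) y y)]
              fun w => WithLp.toLp 2 (fun _ => 1) - w := by
            have hc : IsOpen {w : EuclideanSpace ℝ (Fin 1) | w 0 < 1} :=
              isOpen_lt (by fun_prop) continuous_const
            have hm : extChartAt (𝓡∂ 1) y y ∈ {w : EuclideanSpace ℝ (Fin 1) | w 0 < 1} := by
              simp [extChartAt, Icc_chartedSpaceChartAt, hy', IccLeftChart,
                modelWithCornersEuclideanHalfSpace]
            filter_upwards [mem_nhdsWithin_of_mem_nhds (hc.mem_nhds hm), self_mem_nhdsWithin]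
              with w hw hw'
            rw [range_modelWithCornersEuclideanHalfSpace] at hw'
            have a1 : 0 ≤ w 0 := hw'
            have a2 : w 0 < 1 := hw
            ext i
            fin_cases i
            simp [extChartAt, Icc_chartedSpaceChartAt, hy', hx, IccLeftChart, IccRightChart,
              modelWithCornersEuclideanHalfSpace, a1, a2.le]
          refine h1.hasFDerivWithinAt.congr_of_eventuallyEq h2 (h2.eq_of_nhdsWithin ?_)
          exact ⟨_, rfl⟩
        have hd : (-ContinuousLinearMap.id ℝ (EuclideanSpace ℝ (Fin 1))).det = -1 := by
          have := LinearMap.det_smul (-1 : ℝ) (LinearMap.id (R := ℝ) (M := EuclideanSpace ℝ (Fin 1)))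
          simpa [ContinuousLinearMap.det] using this
        rw [h, hd]
        simp [hx, hy', Units.smul_def]
      · rw [key y x (by simp [Icc_chartedSpaceChartAt, hx, hy'])]
        simp [hx, hy']

end Product

section Objects

open scoped Manifold ContDiff

/-- A path-connected space with a base point. -/
structure PtdSpace where
  carrier : Type u
  [top : TopologicalSpace carrier]
  [conn : PathConnectedSpace carrier]
  pt : carrier

attribute [instance] PtdSpace.top PtdSpace.conn

/-- Continuous maps preserving the base point. -/
structure PtdMap (X Y : PtdSpace.{u}) where
  map : C(X.carrier, Y.carrier)
  map_pt : map X.pt = Y.pt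

/-- A closed (compact, without boundary) oriented smooth `n`-manifold with exactly one base point
in each connected component. -/
structure ClosedMfd (n : ℕ) where
  carrier : Type
  [top : TopologicalSpace carrier]
  [t2 : T2Space carrier]
  [compact : CompactSpace carrier]
  [charted : ChartedSpace (EuclideanSpace ℝ (Fin n)) carrier]
  [smooth : IsManifold (𝓡 n) ∞ carrier]
  orient : Orient (𝓡 n) carrier
  base : Set carrier
  base_unique : ∀ x, ∃! b, b ∈ base ∧ b ∈ connectedComponent x

attribute [instance] ClosedMfd.top ClosedMfd.t2 ClosedMfd.compact ClosedMfd.charted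
  ClosedMfd.smooth

/-- An `X`-manifold of dimension `n`: a closed manifold with a characteristic map to `X` taking the
base points to the base point. -/
structure XMfd (n : ℕ) (X : PtdSpace.{u}) where
  M : ClosedMfd n
  g : C(M.carrier, X.carrier)
  g_base : ∀ b ∈ M.base, g b = X.pt

variable {n : ℕ} {X Y : PtdSpace.{u}}

/-- An `X`-diffeomorphism: a diffeomorphism preserving the orientation, the base points and the
characteristic maps. -/
@[ext]
structure XDiffeo (A B : XMfd n X) where
  diffeo : Diffeomorph (𝓡 n) (𝓡 n) A.M.carrier B.M.carrier ∞
  preserves : Preserves A.M.orient B.M.orient diffeo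
  base : ∀ x, diffeo x ∈ B.M.base ↔ x ∈ A.M.base
  comm : ∀ x, B.g (diffeo x) = A.g x

namespace XDiffeo

def refl (A : XMfd n X) : XDiffeo A A :=
  ⟨.refl _ _ _, .id _, fun _ => Iff.rfl, fun _ => rfl⟩

def trans {A B C : XMfd n X} (f : XDiffeo A B) (g : XDiffeo B C) : XDiffeo A C :=
  ⟨f.diffeo.trans g.diffeo,
    .comp (f := f.diffeo) (g := g.diffeo) g.preserves f.preserves g.diffeo.contMDiff
      f.diffeo.contMDiff,
    fun x => (g.base _).trans (f.base x), fun x => (g.comm _).trans (f.comm x)⟩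

def symm {A B : XMfd n X} (f : XDiffeo A B) : XDiffeo B A :=
  ⟨f.diffeo.symm, f.preserves.symm,
    fun x => by rw [← f.base, Diffeomorph.apply_symm_apply],
    fun x => by rw [← f.comm, Diffeomorph.apply_symm_apply]⟩

theorem hext {A B : XMfd n X} {f g : XDiffeo A B} (h : ∀ x, f.diffeo x = g.diffeo x) : f = g :=
  XDiffeo.ext (Diffeomorph.ext h)

end XDiffeo

/-- The category `Diff(n,X)` of `X`-manifolds and `X`-diffeomorphisms. -/
instance : Category (XMfd n X) where
  Hom := XDiffeo
  id := XDiffeo.refl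
  comp := XDiffeo.trans
  id_comp _ := XDiffeo.hext fun _ => rfl
  comp_id _ := XDiffeo.hext fun _ => rfl
  assoc _ _ _ := XDiffeo.hext fun _ => rfl

@[ext]
theorem XMfd.hom_ext {A B : XMfd n X} {f g : A ⟶ B} (h : ∀ x, f.diffeo x = g.diffeo x) : f = g :=
  XDiffeo.hext h

/-- An `X`-diffeomorphism is an isomorphism of the category of `X`-manifolds. -/
def XDiffeo.iso {A B : XMfd n X} (f : XDiffeo A B) : A ≅ B where
  hom := f
  inv := f.symm
  hom_inv_id := XDiffeo.hext fun x => f.diffeo.symm_apply_apply x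
  inv_hom_id := XDiffeo.hext fun x => f.diffeo.apply_symm_apply x

theorem connectedComponent_inl {M N : Type} [TopologicalSpace M] [TopologicalSpace N] (x : M) :
    connectedComponent (Sum.inl x : M ⊕ N) = Sum.inl '' connectedComponent x := by
  apply subset_antisymm
  · obtain ⟨t, ht, e⟩ | ⟨t, ht, e⟩ :=
      Sum.isPreconnected_iff.1 (isPreconnected_connectedComponent (x := (Sum.inl x : M ⊕ N)))
    · have hx : (Sum.inl x : M ⊕ N) ∈ Sum.inl '' t := e ▸ mem_connectedComponent
      rw [e]
      exact Set.image_mono (ht.subset_connectedComponent (by simpa using hx))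
    · have hx : (Sum.inl x : M ⊕ N) ∈ Sum.inr '' t := e ▸ mem_connectedComponent
      simp at hx
  · exact continuous_inl.image_connectedComponent_subset x

theorem connectedComponent_inr {M N : Type} [TopologicalSpace M] [TopologicalSpace N] (x : N) :
    connectedComponent (Sum.inr x : M ⊕ N) = Sum.inr '' connectedComponent x := by
  apply subset_antisymm
  · obtain ⟨t, ht, e⟩ | ⟨t, ht, e⟩ :=
      Sum.isPreconnected_iff.1 (isPreconnected_connectedComponent (x := (Sum.inr x : M ⊕ N)))
    · have hx : (Sum.inr x : M ⊕ N) ∈ Sum.inl '' t := e ▸ mem_connectedComponent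
      simp at hx
    · have hx : (Sum.inr x : M ⊕ N) ∈ Sum.inr '' t := e ▸ mem_connectedComponent
      rw [e]
      exact Set.image_mono (ht.subset_connectedComponent (by simpa using hx))
  · exact continuous_inr.image_connectedComponent_subset x

/-- Disjoint union of closed manifolds. -/
def ClosedMfd.sum (M N : ClosedMfd n) : ClosedMfd n where
  carrier := M.carrier ⊕ N.carrier
  orient := M.orient.sum N.orient
  base := {x | Sum.elim (· ∈ M.base) (· ∈ N.base) x}
  base_unique := by
    rintro (x | x)
    · obtain ⟨b, hb, hu⟩ := M.base_unique x
      refine ⟨Sum.inl b, by simp [connectedComponent_inl, hb], ?_⟩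
      rintro (y | y) <;> simp [connectedComponent_inl]
      exact fun h h' => hu y ⟨h, h'⟩
    · obtain ⟨b, hb, hu⟩ := N.base_unique x
      refine ⟨Sum.inr b, by simp [connectedComponent_inr, hb], ?_⟩
      rintro (y | y) <;> simp [connectedComponent_inr]
      exact fun h h' => hu y ⟨h, h'⟩

/-- The map on a disjoint union given by two continuous maps. -/
def sumElim {S T Z : Type*} [TopologicalSpace S] [TopologicalSpace T] [TopologicalSpace Z]
    (f : C(S, Z)) (g : C(T, Z)) : C(S ⊕ T, Z) := ⟨Sum.elim f g, f.continuous.sumElim g.continuous⟩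

@[simp] theorem sumElim_inl {S T Z : Type*} [TopologicalSpace S] [TopologicalSpace T]
    [TopologicalSpace Z] (f : C(S, Z)) (g : C(T, Z)) (x : S) : sumElim f g (Sum.inl x) = f x := rfl

@[simp] theorem sumElim_inr {S T Z : Type*} [TopologicalSpace S] [TopologicalSpace T]
    [TopologicalSpace Z] (f : C(S, Z)) (g : C(T, Z)) (x : T) : sumElim f g (Sum.inr x) = g x := rfl

/-- Disjoint union of `X`-manifolds. -/
def XMfd.sum (A B : XMfd n X) : XMfd n X where
  M := A.M.sum B.M
  g := sumElim A.g B.g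
  g_base := by
    rintro (b | b) hb
    exacts [A.g_base b hb, B.g_base b hb]

/-- The empty `X`-manifold. -/
def XMfd.empty (n : ℕ) (X : PtdSpace.{u}) : XMfd n X :=
  letI : ChartedSpace (EuclideanSpace ℝ (Fin n)) Empty := ChartedSpace.empty _ _
  { M :=
    { carrier := Empty
      orient := ⟨fun x => x.elim, fun x => x.elim⟩
      base := ∅
      base_unique := fun x => x.elim }
    g := ⟨fun x => x.elim, by fun_prop⟩
    g_base := fun x => x.elim }

instance : IsEmpty (XMfd.empty n X).M.carrier := inferInstanceAs (IsEmpty Empty)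

namespace XDiffeo

def sum {A A' B B' : XMfd n X} (f : XDiffeo A A') (g : XDiffeo B B') :
    XDiffeo (A.sum B) (A'.sum B') where
  diffeo := f.diffeo.sumCongr g.diffeo
  preserves := .sumMap f.diffeo.contMDiff g.diffeo.contMDiff f.preserves g.preserves
  base := by
    rintro (x | x)
    exacts [f.base x, g.base x]
  comm := by rintro (x | x); exacts [f.comm x, g.comm x]

def assoc (A B C : XMfd n X) : XDiffeo ((A.sum B).sum C) (A.sum (B.sum C)) where
  diffeo := .sumAssoc _ _ _ _ _
  preserves := .sumAssoc _ _ _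
  base := by rintro ((x | x) | x) <;> exact Iff.rfl
  comm := by rintro ((x | x) | x) <;> rfl

def swap (A B : XMfd n X) : XDiffeo (A.sum B) (B.sum A) where
  diffeo := .sumComm _ _ _ _
  preserves := .ofSum (Diffeomorph.contMDiff _) (.inr _ _) (.inl _ _)
  base := by rintro (x | x) <;> exact Iff.rfl
  comm := by rintro (x | x) <;> rfl

def rightUnitor (A : XMfd n X) : XDiffeo (A.sum (.empty n X)) A where
  diffeo := .sumEmpty _ _ _
  preserves := .ofSum (Diffeomorph.contMDiff _) (.id _) (fun x => isEmptyElim x)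
  base := by
    rintro (x | x)
    · exact Iff.rfl
    · exact isEmptyElim x
  comm := by
    rintro (x | x)
    · rfl
    · exact isEmptyElim x

end XDiffeo

/-- The symmetric monoidal structure of `Diff(n,X)`: disjoint union. -/
instance : MonoidalCategory (XMfd n X) where
  tensorObj := XMfd.sum
  tensorUnit := .empty n X
  tensorHom f g := XDiffeo.sum f g
  whiskerLeft A _ _ f := XDiffeo.sum (XDiffeo.refl A) f
  whiskerRight f B := XDiffeo.sum f (XDiffeo.refl B)
  associator A B C := (XDiffeo.assoc A B C).iso
  leftUnitor A := ((XDiffeo.swap _ _).trans (XDiffeo.rightUnitor A)).iso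
  rightUnitor A := (XDiffeo.rightUnitor A).iso
  tensorHom_def _ _ := by ext (x | x) <;> rfl
  id_tensorHom_id _ _ := by ext (x | x) <;> rfl
  tensorHom_comp_tensorHom _ _ _ _ := by ext (x | x) <;> rfl
  whiskerLeft_id _ _ := by ext (x | x) <;> rfl
  id_whiskerRight _ _ := by ext (x | x) <;> rfl
  associator_naturality _ _ _ := by ext ((x | x) | x) <;> rfl
  leftUnitor_naturality _ := by ext (x | x); exacts [isEmptyElim x, rfl]
  rightUnitor_naturality _ := by ext (x | x); exacts [rfl, isEmptyElim x]
  pentagon _ _ _ _ := by ext (((x | x) | x) | x) <;> rfl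
  triangle _ _ := by ext ((x | x) | x); exacts [rfl, isEmptyElim x, rfl]

instance : SymmetricCategory (XMfd n X) where
  braiding A B := (XDiffeo.swap A B).iso
  braiding_naturality_left _ _ := by ext (x | x) <;> rfl
  braiding_naturality_right _ _ _ _ := by ext (x | x) <;> rfl
  hexagon_forward _ _ _ := by ext ((x | x) | x) <;> rfl
  hexagon_reverse _ _ _ := by ext (x | (x | x)) <;> rfl
  symmetry _ _ := by ext (x | x) <;> rfl

end Objects

section Cobordisms

open scoped Manifold ContDiff

/-- The model of manifolds with boundary of dimension `n + 1`: the half space `[0, ∞) × ℝⁿ`. -/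
abbrev HalfSpace (n : ℕ) := ModelProd (EuclideanHalfSpace 1) (EuclideanSpace ℝ (Fin n))

/-- The inclusion of the half space in `ℝ × ℝⁿ`, as a model with corners. -/
abbrev halfModel (n : ℕ) : ModelWithCorners ℝ
    (EuclideanSpace ℝ (Fin 1) × EuclideanSpace ℝ (Fin n)) (HalfSpace n) :=
  (𝓡∂ 1).prod (𝓡 n)

variable {n : ℕ} {X Y : PtdSpace.{u}}

/-- Given the differential `L : ℝⁿ → ℝ × ℝⁿ` of a map into the boundary, the linear endomorphism of
`ℝ × ℝⁿ` consisting of the inward normal vector `(1, 0)` followed by `L`. -/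
def withInward (L : EuclideanSpace ℝ (Fin n) →L[ℝ]
      EuclideanSpace ℝ (Fin 1) × EuclideanSpace ℝ (Fin n)) :
    (EuclideanSpace ℝ (Fin 1) × EuclideanSpace ℝ (Fin n)) →L[ℝ]
      EuclideanSpace ℝ (Fin 1) × EuclideanSpace ℝ (Fin n) :=
  (ContinuousLinearMap.inl ℝ _ _).coprod L

/-- A cobordism `M ⟶ N`: a compact oriented smooth `(n+1)`-manifold with boundary whose boundary is
the disjoint union of `M` and `N`, the orientation induced on the boundary (outward normal first)
agreeing with that of `N` and disagreeing with that of `M`. So an inward normal vector followed by a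
positive frame of `M` is positive, and followed by a positive frame of `N` is negative. (These
conditions also make the inclusions of `M` and `N` immersions.) -/
structure Cobordism (M N : ClosedMfd n) where
  carrier : Type
  [top : TopologicalSpace carrier]
  [t2 : T2Space carrier]
  [compact : CompactSpace carrier]
  [charted : ChartedSpace (HalfSpace n) carrier]
  [smooth : IsManifold (halfModel n) ∞ carrier]
  orient : Orient (halfModel n) carrier
  inn : M.carrier → carrier
  out : N.carrier → carrier
  inn_smooth : ContMDiff (𝓡 n) (halfModel n) ∞ inn
  out_smooth : ContMDiff (𝓡 n) (halfModel n) ∞ out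
  injective : Function.Injective (Sum.elim inn out)
  range : Set.range (Sum.elim inn out) = (halfModel n).boundary carrier
  inn_orient : ∀ x, 0 < (M.orient.sign x * orient.sign (inn x)) •
    (withInward (dAt (𝓡 n) (halfModel n) inn x)).det
  out_orient : ∀ x, (N.orient.sign x * orient.sign (out x)) •
    (withInward (dAt (𝓡 n) (halfModel n) out x)).det < 0

attribute [instance] Cobordism.top Cobordism.t2 Cobordism.compact Cobordism.charted
  Cobordism.smooth

theorem dAt_slice {M : ClosedMfd n} (t : Set.Icc (0 : ℝ) 1) (x : M.carrier) :
    withInward (dAt (𝓡 n) (halfModel n)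
      (fun y => (t, y) : M.carrier → Set.Icc (0 : ℝ) 1 × M.carrier) x) =
      ContinuousLinearMap.id ℝ _ := by
  have : dAt (𝓡 n) (halfModel n) (fun y => (t, y) : M.carrier → Set.Icc (0 : ℝ) 1 × M.carrier) x
      = ContinuousLinearMap.inr ℝ _ _ :=
    ((hasMFDerivAt_const t x).prodMk (hasMFDerivAt_id x)).mfderiv
  rw [this]
  exact ContinuousLinearMap.coprod_inl_inr

theorem injective_sum {A B C D V W : Type} {a : A → V} {b : B → V} {c : C → W} {d : D → W}
    (h₁ : Function.Injective (Sum.elim a b)) (h₂ : Function.Injective (Sum.elim c d)) :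
    Function.Injective (Sum.elim (Sum.map a c) (Sum.map b d)) := by
  rw [Function.Injective] at h₁ h₂
  rintro ((x | x) | (x | x)) ((y | y) | (y | y)) h <;> simp_all <;> grind

/-- The cylinder `I × M`. -/
def Cobordism.cyl (M : ClosedMfd n) : Cobordism M M where
  carrier := Set.Icc (0 : ℝ) 1 × M.carrier
  orient := Orient.interval.prod M.orient
  inn x := (0, x)
  out x := (1, x)
  inn_smooth := contMDiff_const.prodMk contMDiff_id
  out_smooth := contMDiff_const.prodMk contMDiff_id
  injective := by rintro (x | x) (y | y) h <;> simp_all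
  range := by
    have h : (halfModel n).boundary (Set.Icc (0 : ℝ) 1 × M.carrier) = {⊥, ⊤} ×ˢ Set.univ := by
      rw [← boundary_Icc]; exact ModelWithCorners.boundary_of_boundaryless_right
    rw [h, Set.Sum.elim_range]
    ext ⟨t, x⟩
    simp [eq_comm]
    rfl
  inn_orient x := by
    rw [dAt_slice]
    simp [Orient.prod, Orient.interval, ContinuousLinearMap.det]
  out_orient x := by
    rw [dAt_slice]
    simp [Orient.prod, Orient.interval, ContinuousLinearMap.det, Units.smul_def]

/-- Disjoint union of cobordisms. -/
def Cobordism.sum {M N M' N' : ClosedMfd n} (W : Cobordism M N) (V : Cobordism M' N') :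
    Cobordism (M.sum M') (N.sum N') where
  carrier := W.carrier ⊕ V.carrier
  orient := W.orient.sum V.orient
  inn := Sum.map W.inn V.inn
  out := Sum.map W.out V.out
  inn_smooth := W.inn_smooth.sumMap V.inn_smooth
  out_smooth := W.out_smooth.sumMap V.out_smooth
  injective := injective_sum W.injective V.injective
  range := by
    rw [ModelWithCorners.boundary_disjointUnion, ← W.range, ← V.range]
    ext (x | x) <;> simp [ClosedMfd.sum]
  inn_orient := by
    rintro (x | x)
    · have h := W.inn_orient x
      rw [← dAt_sumMap_inl W.inn_smooth V.inn_smooth x] at h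
      exact h
    · have h := V.inn_orient x
      rw [← dAt_sumMap_inr W.inn_smooth V.inn_smooth x] at h
      exact h
  out_orient := by
    rintro (x | x)
    · have h := W.out_orient x
      rw [← dAt_sumMap_inl W.out_smooth V.out_smooth x] at h
      exact h
    · have h := V.out_orient x
      rw [← dAt_sumMap_inr W.out_smooth V.out_smooth x] at h
      exact h

end Cobordisms

section XCobordisms

open scoped Manifold ContDiff

variable {n : ℕ} {X Y : PtdSpace.{u}}

/-- Maps from a cobordism to `X` that restrict to the characteristic maps on the boundary. -/
def XMap (A B : XMfd n X) (W : Cobordism A.M B.M) :=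
  {F : C(W.carrier, X.carrier) // (∀ x, F (W.inn x) = A.g x) ∧ ∀ x, F (W.out x) = B.g x}

/-- Homotopy relative to the boundary. -/
def homotopySetoid (A B : XMfd n X) (W : Cobordism A.M B.M) : Setoid (XMap A B W) where
  r F G := F.1.HomotopicRel G.1 ((halfModel n).boundary W.carrier)
  iseqv := ⟨fun _ => .refl _, fun h => h.symm, fun h h' => h.trans h'⟩

/-- An `X`-cobordism: a cobordism with a homotopy class, relative to the boundary, of maps to `X`
restricting to the characteristic maps on the boundary. -/
structure XCob (A B : XMfd n X) where
  W : Cobordism A.M B.M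
  F : Quotient (homotopySetoid A B W)

/-- The homotopy class of a map. -/
def XMap.cls {A B : XMfd n X} {W : Cobordism A.M B.M} (F : XMap A B W) :
    Quotient (homotopySetoid A B W) := Quotient.mk _ F

/-- The identity cobordism of an `X`-manifold `(M, g)`: the cylinder `I × M` with the map
`(t, x) ↦ g x`. -/
def XCob.cyl (A : XMfd n X) : XCob A A where
  W := .cyl A.M
  F := XMap.cls ⟨⟨fun p => A.g p.2, by fun_prop⟩, fun _ => rfl, fun _ => rfl⟩

def XMap.sum {A B A' B' : XMfd n X} {W : Cobordism A.M B.M} {V : Cobordism A'.M B'.M}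
    (F : XMap A B W) (G : XMap A' B' V) : XMap (A ⊗ A') (B ⊗ B') (W.sum V) :=
  ⟨sumElim F.1 G.1, by rintro (x | x); exacts [F.2.1 x, G.2.1 x],
    by rintro (x | x); exacts [F.2.2 x, G.2.2 x]⟩

theorem homotopicRel_sum {S T Z : Type*} [TopologicalSpace S] [TopologicalSpace T]
    [TopologicalSpace Z] {F F' : C(S, Z)} {G G' : C(T, Z)} {s : Set S} {t : Set T}
    (h : F.HomotopicRel F' s) (h' : G.HomotopicRel G' t) :
    (sumElim F G).HomotopicRel (sumElim F' G') (Sum.inl '' s ∪ Sum.inr '' t) := by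
  obtain ⟨H⟩ := h
  obtain ⟨K⟩ := h'
  refine ⟨⟨⟨⟨fun p => Sum.elim H K (Homeomorph.prodSumDistrib p), by fun_prop⟩, ?_, ?_⟩, ?_⟩⟩
  · rintro (x | x)
    exacts [H.map_zero_left x, K.map_zero_left x]
  · rintro (x | x)
    exacts [H.map_one_left x, K.map_one_left x]
  · rintro r _ (⟨x, hx, rfl⟩ | ⟨x, hx, rfl⟩)
    exacts [H.eq_fst r hx, K.eq_fst r hx]

/-- Disjoint union of `X`-cobordisms. -/
def XCob.sum {A B A' B' : XMfd n X} (W : XCob A B) (V : XCob A' B') :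
    XCob (A ⊗ A') (B ⊗ B') where
  W := W.W.sum V.W
  F := Quotient.map₂ XMap.sum (fun _ _ h _ _ h' => by
    have := homotopicRel_sum h h'
    rw [← ModelWithCorners.boundary_disjointUnion] at this
    exact this) W.F V.F

/-- An `X`-diffeomorphism between `X`-cobordisms `(W, F)` and `(V, G)`: an orientation preserving
diffeomorphism `Ψ` restricting to `X`-diffeomorphisms of the incoming and of the outgoing
boundaries, with `F = G ∘ Ψ` as homotopy classes. -/
structure CobDiffeo {A B A' B' : XMfd n X} (W : XCob A B) (V : XCob A' B') where
  diffeo : Diffeomorph (halfModel n) (halfModel n) W.W.carrier V.W.carrier ∞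
  preserves : Preserves W.W.orient V.W.orient diffeo
  inn : A ⟶ A'
  out : B ⟶ B'
  diffeo_inn : ∀ x, diffeo (W.W.inn x) = V.W.inn (inn.diffeo x)
  diffeo_out : ∀ x, diffeo (W.W.out x) = V.W.out (out.diffeo x)
  comm : ∃ (F : XMap A B W.W) (G : XMap A' B' V.W), F.cls = W.F ∧ G.cls = V.F ∧
    ∀ x, G.1 (diffeo x) = F.1 x

/-- `Q` is a gluing of the `X`-cobordisms `W : A ⟶ B` and `V : B' ⟶ C` along the
`X`-diffeomorphism `ψ : B ⟶ B'`: there are orientation preserving smooth embeddings of `W` and of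
`V` in `Q` that together cover `Q` and overlap exactly in the outgoing boundary of `W`, identified
with the incoming boundary of `V` by means of `ψ`; the boundary of `Q` is made of the incoming
boundary of `W` and the outgoing boundary of `V`; and the homotopy class of `Q` is that of a map
obtained from representatives of the homotopy classes of `W` and `V`. (The smooth structure of a
gluing is determined only up to diffeomorphisms that are the identity on the boundary, so that there
are many gluings, all of them `X`-diffeomorphic relative to the boundary.) -/
structure Gluing {A B B' C : XMfd n X} (W : XCob A B) (ψ : B ⟶ B') (V : XCob B' C)
    (Q : XCob A C) where
  left : W.W.carrier → Q.W.carrier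
  right : V.W.carrier → Q.W.carrier
  left_smooth : ContMDiff (halfModel n) (halfModel n) ∞ left
  right_smooth : ContMDiff (halfModel n) (halfModel n) ∞ right
  left_preserves : Preserves W.W.orient Q.W.orient left
  right_preserves : Preserves V.W.orient Q.W.orient right
  left_injective : Function.Injective left
  right_injective : Function.Injective right
  cover : ∀ q, q ∈ Set.range left ∨ q ∈ Set.range right
  overlap : ∀ w v, left w = right v ↔ ∃ y, w = W.W.out y ∧ v = V.W.inn (ψ.diffeo y)
  inn : ∀ x, left (W.W.inn x) = Q.W.inn x
  out : ∀ x, right (V.W.out x) = Q.W.out x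
  cls : ∃ (F : XMap A B W.W) (G : XMap B' C V.W) (K : XMap A C Q.W),
    F.cls = W.F ∧ G.cls = V.F ∧ K.cls = Q.F ∧ (∀ w, K.1 (left w) = F.1 w) ∧
    ∀ v, K.1 (right v) = G.1 v

/-- Any two empty cobordisms are `X`-diffeomorphic. -/
def CobDiffeo.ofEmpty {A B A' B' : XMfd n X} (W : XCob A B) (V : XCob A' B')
    [IsEmpty W.W.carrier] [IsEmpty V.W.carrier] (a : A ⟶ A') (b : B ⟶ B') : CobDiffeo W V where
  diffeo := .empty
  preserves x := isEmptyElim x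
  inn := a
  out := b
  diffeo_inn x := isEmptyElim (W.W.inn x)
  diffeo_out x := isEmptyElim (W.W.out x)
  comm := by
    obtain ⟨F, hF⟩ := Quotient.exists_rep W.F
    obtain ⟨G, hG⟩ := Quotient.exists_rep V.F
    exact ⟨F, G, hF, hG, fun x => isEmptyElim x⟩

end XCobordisms

section Push

open scoped Manifold ContDiff

variable {n : ℕ} {X Y : PtdSpace.{u}} (f : PtdMap X Y)

/-- Composition of the characteristic map with a map `X ⟶ Y`. -/
def XMfd.push (A : XMfd n X) : XMfd n Y :=
  ⟨A.M, f.map.comp A.g, fun b hb => by simp [A.g_base b hb, f.map_pt]⟩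

def XDiffeo.push {A B : XMfd n X} (ψ : A ⟶ B) : A.push f ⟶ B.push f :=
  ⟨ψ.diffeo, ψ.preserves, ψ.base, fun x => congrArg f.map (ψ.comm x)⟩

def pushFunctor : XMfd n X ⥤ XMfd n Y where
  obj A := A.push f
  map ψ := XDiffeo.push f ψ

def pushSum (A B : XMfd n X) : A.push f ⊗ B.push f ⟶ (A ⊗ B).push f where
  diffeo := .refl _ _ _
  preserves := .id (A ⊗ B).M.orient
  base _ := Iff.rfl
  comm := by rintro (x | x) <;> rfl

def pushEmpty : XMfd.empty n Y ⟶ (XMfd.empty n X).push f where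
  diffeo := .refl _ _ _
  preserves := .id (XMfd.empty n X).M.orient
  base _ := Iff.rfl
  comm x := isEmptyElim x

instance : (pushFunctor (n := n) f).Braided :=
  letI : (pushFunctor (n := n) f).Monoidal := Functor.CoreMonoidal.toMonoidal
    { εIso := XDiffeo.iso (pushEmpty f)
      μIso A B := XDiffeo.iso (pushSum f A B)
      μIso_hom_natural_left _ _ := by ext (x | x) <;> rfl
      μIso_hom_natural_right _ _ := by ext (x | x) <;> rfl
      associativity _ _ _ := by ext ((x | x) | x) <;> rfl
      left_unitality _ := by ext (x | x); exacts [Empty.elim x, rfl]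
      right_unitality _ := by ext (x | x); exacts [rfl, Empty.elim x] }
  { braided _ _ := by ext (x | x) <;> rfl }

def XMap.push {A B : XMfd n X} {W : Cobordism A.M B.M} (F : XMap A B W) :
    XMap (A.push f) (B.push f) W :=
  ⟨f.map.comp F.1, fun x => congrArg f.map (F.2.1 x), fun x => congrArg f.map (F.2.2 x)⟩

def XCob.push {A B : XMfd n X} (W : XCob A B) : XCob (A.push f) (B.push f) where
  W := W.W
  F := Quotient.map (XMap.push f)
    (fun _ _ h => ContinuousMap.HomotopicRel.comp_continuousMap h f.map) W.F

theorem XMap.push_cls {A B : XMfd n X} {W : XCob A B} {F : XMap A B W.W} (h : F.cls = W.F) :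
    (F.push f).cls = (W.push f).F := by
  simp only [XCob.push, ← h]; rfl

def CobDiffeo.push {A B A' B' : XMfd n X} {W : XCob A B} {V : XCob A' B'} (Ψ : CobDiffeo W V) :
    CobDiffeo (W.push f) (V.push f) where
  diffeo := Ψ.diffeo
  preserves := Ψ.preserves
  inn := XDiffeo.push f Ψ.inn
  out := XDiffeo.push f Ψ.out
  diffeo_inn := Ψ.diffeo_inn
  diffeo_out := Ψ.diffeo_out
  comm := by
    obtain ⟨F, G, hF, hG, h⟩ := Ψ.comm
    exact ⟨F.push f, G.push f, F.push_cls f hF, G.push_cls f hG, fun x => congrArg f.map (h x)⟩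

def Gluing.push {A B B' C : XMfd n X} {W : XCob A B} {ψ : B ⟶ B'} {V : XCob B' C} {Q : XCob A C}
    (h : Gluing W ψ V Q) : Gluing (W.push f) (XDiffeo.push f ψ) (V.push f) (Q.push f) :=
  { h with
    cls := by
      obtain ⟨F, G, K, hF, hG, hK, e, e'⟩ := h.cls
      exact ⟨F.push f, G.push f, K.push f, F.push_cls f hF, G.push_cls f hG, K.push_cls f hK,
        fun x => congrArg f.map (e x), fun x => congrArg f.map (e' x)⟩ }

theorem XCob.push_cyl (A : XMfd n X) : (XCob.cyl A).push f = XCob.cyl (A.push f) := rfl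

/-- The identity map, as a diffeomorphism of `X`-cobordisms. -/
def CobDiffeo.pushSum {A B A' B' : XMfd n X} (W : XCob A B) (V : XCob A' B') :
    CobDiffeo ((W.push f).sum (V.push f)) ((W.sum V).push f) where
  diffeo := .refl _ _ _
  preserves := .id (W.W.sum V.W).orient
  inn := HQFTs.pushSum f A A'
  out := HQFTs.pushSum f B B'
  diffeo_inn _ := rfl
  diffeo_out _ := rfl
  comm := by
    obtain ⟨W, ⟨F⟩⟩ := W
    obtain ⟨V, ⟨G⟩⟩ := V
    refine ⟨(F.push f).sum (G.push f), (F.sum G).push f, rfl, rfl, ?_⟩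
    rintro (x | x) <;> rfl

end Push

section Strings

variable {n : ℕ} {X : PtdSpace.{u}}

/-- The generating edges: `X`-diffeomorphisms and `X`-cobordisms. -/
inductive Gen (A B : XMfd n X) : Type (max 1 u)
  | diff (ψ : A ⟶ B) : Gen A B
  | cob (W : XCob A B) : Gen A B

/-- The free category without units on the graph whose vertices are the `X`-manifolds and whose
edges are the `X`-diffeomorphisms and the `X`-cobordisms: non-empty composable strings. -/
inductive Str : XMfd n X → XMfd n X → Type (max 1 u)
  | gen {A B : XMfd n X} (a : Gen A B) : Str A B
  | cons {A B C : XMfd n X} (a : Gen A B) (s : Str B C) : Str A C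

/-- The string consisting of one `X`-diffeomorphism. -/
abbrev Str.diff {A B : XMfd n X} (ψ : A ⟶ B) : Str A B := .gen (.diff ψ)

/-- The string consisting of one `X`-cobordism. -/
abbrev Str.cob {A B : XMfd n X} (W : XCob A B) : Str A B := .gen (.cob W)

/-- Concatenation of strings. -/
def Str.append : {A B C : XMfd n X} → Str A B → Str B C → Str A C
  | _, _, _, .gen a, t => .cons a t
  | _, _, _, .cons a s, t => .cons a (s.append t)

theorem Str.append_assoc : {A B C D : XMfd n X} → (s : Str A B) → (t : Str B C) → (r : Str C D) →
    (s.append t).append r = s.append (t.append r)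
  | _, _, _, _, .gen _, _, _ => rfl
  | _, _, _, _, .cons a s, t, r => congrArg (Str.cons a) (s.append_assoc t r)

/-- Disjoint union with (the identity of) `P` on the right. -/
def Gen.whiskerRight {A B : XMfd n X} (P : XMfd n X) : Gen A B → Gen (A ⊗ P) (B ⊗ P)
  | .diff ψ => .diff (ψ ▷ P)
  | .cob W => .cob (W.sum (.cyl P))

/-- Disjoint union with (the identity of) `P` on the left. -/
def Gen.whiskerLeft (P : XMfd n X) {A B : XMfd n X} : Gen A B → Gen (P ⊗ A) (P ⊗ B)
  | .diff ψ => .diff (P ◁ ψ)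
  | .cob W => .cob ((XCob.cyl P).sum W)

def Str.whiskerRight (P : XMfd n X) : {A B : XMfd n X} → Str A B → Str (A ⊗ P) (B ⊗ P)
  | _, _, .gen a => .gen (a.whiskerRight P)
  | _, _, .cons a s => .cons (a.whiskerRight P) (s.whiskerRight P)

def Str.whiskerLeft (P : XMfd n X) : {A B : XMfd n X} → Str A B → Str (P ⊗ A) (P ⊗ B)
  | _, _, .gen a => .gen (a.whiskerLeft P)
  | _, _, .cons a s => .cons (a.whiskerLeft P) (s.whiskerLeft P)

theorem Str.whiskerRight_append (P : XMfd n X) : {A B C : XMfd n X} → (s : Str A B) →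
    (t : Str B C) → (s.append t).whiskerRight P = (s.whiskerRight P).append (t.whiskerRight P)
  | _, _, _, .gen _, _ => rfl
  | _, _, _, .cons a s, t => congrArg (Str.cons (a.whiskerRight P)) (s.whiskerRight_append P t)

theorem Str.whiskerLeft_append (P : XMfd n X) : {A B C : XMfd n X} → (s : Str A B) →
    (t : Str B C) → (s.append t).whiskerLeft P = (s.whiskerLeft P).append (t.whiskerLeft P)
  | _, _, _, .gen _, _ => rfl
  | _, _, _, .cons a s, t => congrArg (Str.cons (a.whiskerLeft P)) (s.whiskerLeft_append P t)

/-- The monoidal congruence on strings that defines the homotopy cobordism category. -/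
inductive Rel : {A B : XMfd n X} → Str A B → Str A B → Prop
  -- a congruence, compatible with disjoint union
  | refl {A B : XMfd n X} (s : Str A B) : Rel s s
  | symm {A B : XMfd n X} {s t : Str A B} : Rel s t → Rel t s
  | trans {A B : XMfd n X} {s t r : Str A B} : Rel s t → Rel t r → Rel s r
  | append {A B C : XMfd n X} {s s' : Str A B} {t t' : Str B C} :
      Rel s s' → Rel t t' → Rel (s.append t) (s'.append t')
  | whiskerRight (P : XMfd n X) {A B : XMfd n X} {s t : Str A B} :
      Rel s t → Rel (s.whiskerRight P) (t.whiskerRight P)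
  | whiskerLeft (P : XMfd n X) {A B : XMfd n X} {s t : Str A B} :
      Rel s t → Rel (s.whiskerLeft P) (t.whiskerLeft P)
  -- composition of diffeomorphisms, gluing of cobordisms, and identities
  | diff_comp {A B C : XMfd n X} (ψ : A ⟶ B) (φ : B ⟶ C) :
      Rel ((Str.diff ψ).append (.diff φ)) (.diff (ψ ≫ φ))
  | glue {A B C : XMfd n X} {W : XCob A B} {V : XCob B C} {Q : XCob A C} :
      Gluing W (𝟙 B) V Q → Rel ((Str.cob W).append (.cob V)) (.cob Q)
  | cyl (A : XMfd n X) : Rel (Str.cob (.cyl A)) (.diff (𝟙 A))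
  -- disjoint union is a functor in two variables, extending the one of cobordisms
  | exchange {A B A' B' : XMfd n X} (a : Gen A B) (b : Gen A' B') :
      Rel ((Str.gen (a.whiskerRight A')).append (.gen (b.whiskerLeft B)))
        ((Str.gen (b.whiskerLeft A)).append (.gen (a.whiskerRight B')))
  | sum_cob {A B A' B' : XMfd n X} (W : XCob A B) (V : XCob A' B') :
      Rel (Str.cob (W.sum V))
        ((Str.cob (W.sum (.cyl A'))).append (.cob ((XCob.cyl B).sum V)))
  -- the structural diffeomorphisms are natural for cobordisms
  | assoc {A B A' B' A'' B'' : XMfd n X} (W : XCob A B) (V : XCob A' B') (U : XCob A'' B'') :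
      Rel ((Str.cob ((W.sum V).sum U)).append (.diff (α_ B B' B'').hom))
        ((Str.diff (α_ A A' A'').hom).append (.cob (W.sum (V.sum U))))
  | leftUnit {A B : XMfd n X} (W : XCob A B) :
      Rel ((Str.cob ((XCob.cyl (𝟙_ _)).sum W)).append (.diff (λ_ B).hom))
        ((Str.diff (λ_ A).hom).append (.cob W))
  | rightUnit {A B : XMfd n X} (W : XCob A B) :
      Rel ((Str.cob (W.sum (.cyl (𝟙_ _)))).append (.diff (ρ_ B).hom))
        ((Str.diff (ρ_ A).hom).append (.cob W))
  | braid {A B A' B' : XMfd n X} (W : XCob A B) (V : XCob A' B') :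
      Rel ((Str.cob (W.sum V)).append (.diff (β_ B B').hom))
        ((Str.diff (β_ A A').hom).append (.cob (V.sum W)))
  -- diffeomorphisms of cobordisms, gluing along a diffeomorphism, and units
  | cobDiffeo {A B A' B' : XMfd n X} {W : XCob A B} {V : XCob A' B'} (Ψ : CobDiffeo W V) :
      Rel ((Str.cob W).append (.diff Ψ.out)) ((Str.diff Ψ.inn).append (.cob V))
  | glue_along {A B B' C : XMfd n X} {W : XCob A B} {ψ : B ⟶ B'} {V : XCob B' C} {Q : XCob A C} :
      Gluing W ψ V Q → Rel ((Str.cob W).append ((Str.diff ψ).append (.cob V))) (.cob Q)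
  | cob_cyl {A B : XMfd n X} (W : XCob A B) : Rel ((Str.cob W).append (.cob (.cyl B))) (.cob W)
  | cyl_cob {A B : XMfd n X} (W : XCob A B) : Rel ((Str.cob (.cyl A)).append (.cob W)) (.cob W)

theorem Rel.id_append {A B : XMfd n X} (s : Str A B) : Rel ((Str.diff (𝟙 A)).append s) s := by
  have h : ∀ {C D : XMfd n X} (a : Gen C D), Rel ((Str.diff (𝟙 C)).append (.gen a)) (.gen a) := by
    rintro C D (ψ | W)
    · simpa using Rel.diff_comp (𝟙 C) ψ
    · exact ((Rel.cyl C).symm.append (.refl _)).trans (.cyl_cob W)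
  cases s with
  | gen a => exact h a
  | cons a s => exact (h a).append (.refl s)

theorem Rel.append_id {A B : XMfd n X} (s : Str A B) : Rel (s.append (Str.diff (𝟙 B))) s := by
  induction s with
  | @gen C D a =>
    obtain ψ | W := a
    · simpa using Rel.diff_comp ψ (𝟙 D)
    · exact (Rel.append (.refl _) (Rel.cyl D).symm).trans (.cob_cyl W)
  | cons a s ih => exact Rel.append (.refl (.gen a)) ih

/-- Strings modulo the congruence. -/
def relSetoid (A B : XMfd n X) : Setoid (Str A B) := ⟨Rel, .refl, .symm, .trans⟩

end Strings

/-- The homotopy cobordism category: its objects are the `X`-manifolds. -/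
structure HCobord (n : ℕ) (X : PtdSpace.{u}) where
  as : XMfd n X

namespace HCobord

variable {n : ℕ} {X : PtdSpace.{u}}

/-- The morphisms of the homotopy cobordism category are the classes of strings of
`X`-diffeomorphisms and `X`-cobordisms, composed by concatenation; the identity is the class of the
identity `X`-diffeomorphism. -/
instance : Category (HCobord n X) where
  Hom A B := Quotient (relSetoid A.as B.as)
  id A := Quotient.mk _ (.diff (𝟙 A.as))
  comp := Quotient.map₂ Str.append fun _ _ h _ _ h' => Rel.append h h'
  id_comp := by rintro _ _ ⟨s⟩; exact Quotient.sound (Rel.id_append s)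
  comp_id := by rintro _ _ ⟨s⟩; exact Quotient.sound (Rel.append_id s)
  assoc := by rintro _ _ _ _ ⟨s⟩ ⟨t⟩ ⟨r⟩; exact congrArg (Quotient.mk _) (s.append_assoc t r)

/-- The class of a string. -/
def cls {A B : XMfd n X} (s : Str A B) : (⟨A⟩ : HCobord n X) ⟶ ⟨B⟩ := Quotient.mk _ s

/-- The class of an `X`-diffeomorphism. -/
abbrev ofDiff {A B : XMfd n X} (ψ : A ⟶ B) : (⟨A⟩ : HCobord n X) ⟶ ⟨B⟩ := cls (.diff ψ)

/-- The class of an `X`-cobordism. -/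
abbrev ofCob {A B : XMfd n X} (W : XCob A B) : (⟨A⟩ : HCobord n X) ⟶ ⟨B⟩ := cls (.cob W)

theorem sound {A B : XMfd n X} {s t : Str A B} (h : Rel s t) : cls s = cls t := Quotient.sound h

theorem ofDiff_comp {A B C : XMfd n X} (ψ : A ⟶ B) (φ : B ⟶ C) :
    ofDiff (ψ ≫ φ) = ofDiff ψ ≫ ofDiff φ := (sound (.diff_comp ψ φ)).symm

theorem ofDiff_id (A : XMfd n X) : ofDiff (𝟙 A) = 𝟙 (⟨A⟩ : HCobord n X) := rfl

theorem ofCob_cyl (A : XMfd n X) : ofCob (.cyl A) = 𝟙 (⟨A⟩ : HCobord n X) := sound (.cyl A)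

/-- The isomorphism given by an isomorphism of `X`-manifolds. -/
def ofIso {A B : XMfd n X} (e : A ≅ B) : (⟨A⟩ : HCobord n X) ≅ ⟨B⟩ where
  hom := ofDiff e.hom
  inv := ofDiff e.inv
  hom_inv_id := by rw [← ofDiff_comp, e.hom_inv_id]; rfl
  inv_hom_id := by rw [← ofDiff_comp, e.inv_hom_id]; rfl

theorem ind {P : ∀ {A B : HCobord n X}, (A ⟶ B) → Prop}
    (diff : ∀ {A B : XMfd n X} (ψ : A ⟶ B), P (ofDiff ψ))
    (cob : ∀ {A B : XMfd n X} (W : XCob A B), P (ofCob W))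
    (comp : ∀ {A B C : HCobord n X} (f : A ⟶ B) (g : B ⟶ C), P f → P g → P (f ≫ g))
    {A B : HCobord n X} (f : A ⟶ B) : P f := by
  obtain ⟨s⟩ := f
  have gen : ∀ {A B : XMfd n X} (a : Gen A B), P (cls (.gen a)) := by
    rintro A B (ψ | W)
    exacts [diff ψ, cob W]
  have : ∀ {A B : XMfd n X} (s : Str A B), P (cls s) := by
    intro A B s
    induction s with
    | gen a => exact gen a
    | cons a s ih => exact comp (cls (.gen a)) (cls s) (gen a) ih
  exact this s

instance : MonoidalCategoryStruct (HCobord n X) where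
  tensorObj A B := ⟨A.as ⊗ B.as⟩
  tensorUnit := ⟨𝟙_ _⟩
  whiskerLeft P _ _ := Quotient.map (Str.whiskerLeft P.as) fun _ _ h => Rel.whiskerLeft P.as h
  whiskerRight f P := Quotient.map (Str.whiskerRight P.as) (fun _ _ h => Rel.whiskerRight P.as h) f
  tensorHom {_ B A' _} f g :=
    Quotient.map (Str.whiskerRight A'.as) (fun _ _ h => Rel.whiskerRight A'.as h) f ≫
      Quotient.map (Str.whiskerLeft B.as) (fun _ _ h => Rel.whiskerLeft B.as h) g
  associator A B C := ofIso (α_ A.as B.as C.as)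
  leftUnitor A := ofIso (λ_ A.as)
  rightUnitor A := ofIso (ρ_ A.as)

theorem comp_wR {A B C : HCobord n X} (f : A ⟶ B) (g : B ⟶ C) (P : HCobord n X) :
    (f ≫ g) ▷ P = f ▷ P ≫ g ▷ P := by
  obtain ⟨s⟩ := f
  obtain ⟨t⟩ := g
  exact congrArg (Quotient.mk _) (s.whiskerRight_append P.as t)

theorem comp_wL {A B C : HCobord n X} (f : A ⟶ B) (g : B ⟶ C) (P : HCobord n X) :
    P ◁ (f ≫ g) = P ◁ f ≫ P ◁ g := by
  obtain ⟨s⟩ := f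
  obtain ⟨t⟩ := g
  exact congrArg (Quotient.mk _) (s.whiskerLeft_append P.as t)

theorem id_wR (A P : HCobord n X) : 𝟙 A ▷ P = 𝟙 (A ⊗ P) :=
  congrArg ofDiff (id_whiskerRight A.as P.as)

theorem wL_id (A P : HCobord n X) : P ◁ 𝟙 A = 𝟙 (P ⊗ A) :=
  congrArg ofDiff (whiskerLeft_id P.as A.as)

theorem exch {A B A' B' : HCobord n X} (f : A ⟶ B) (g : A' ⟶ B') :
    f ▷ A' ≫ B ◁ g = A ◁ g ≫ f ▷ B' := by
  revert A' B'
  refine ind (P := fun {A B} f => ∀ {A' B' : HCobord n X} (g : A' ⟶ B'),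
    f ▷ A' ≫ B ◁ g = A ◁ g ≫ f ▷ B') ?_ ?_ ?_ f
  · intro A B ψ A' B' g
    refine ind (P := fun {A' B'} g => ofDiff ψ ▷ A' ≫ _ ◁ g = _ ◁ g ≫ ofDiff ψ ▷ B')
      ?_ ?_ ?_ g
    · exact fun φ => sound (.exchange (.diff ψ) (.diff φ))
    · exact fun φ => sound (.exchange (.diff ψ) (.cob φ))
    · intro _ _ _ g h hg hh
      rw [comp_wL, comp_wL, ← Category.assoc, hg, Category.assoc, hh, Category.assoc]
  · intro A B ψ A' B' g
    refine ind (P := fun {A' B'} g => ofCob ψ ▷ A' ≫ _ ◁ g = _ ◁ g ≫ ofCob ψ ▷ B')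
      ?_ ?_ ?_ g
    · exact fun φ => sound (.exchange (.cob ψ) (.diff φ))
    · exact fun φ => sound (.exchange (.cob ψ) (.cob φ))
    · intro _ _ _ g h hg hh
      rw [comp_wL, comp_wL, ← Category.assoc, hg, Category.assoc, hh, Category.assoc]
  · intro _ _ _ f f' hf hf' _ _ g
    rw [comp_wR, comp_wR, Category.assoc, hf', ← Category.assoc, hf, Category.assoc]

theorem ofCob_sum {A B A' B' : XMfd n X} (W : XCob A B) (V : XCob A' B') :
    ofCob (W.sum V) = ofCob W ▷ ⟨A'⟩ ≫ (⟨B⟩ : HCobord n X) ◁ ofCob V :=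
  sound (.sum_cob W V)

theorem ofCob_cyl_sum (A B : XMfd n X) :
    ofCob ((XCob.cyl A).sum (.cyl B)) = 𝟙 (⟨A ⊗ B⟩ : HCobord n X) := by
  rw [ofCob_sum, ofCob_cyl, ofCob_cyl, id_wR, wL_id]; exact Category.comp_id _

theorem assoc_left {A B : HCobord n X} (f : A ⟶ B) (P Q : HCobord n X) :
    (f ▷ P) ▷ Q ≫ (α_ B P Q).hom = (α_ A P Q).hom ≫ f ▷ (P ⊗ Q) := by
  refine ind (P := fun {A B} f => (f ▷ P) ▷ Q ≫ (α_ B P Q).hom = (α_ A P Q).hom ≫ f ▷ (P ⊗ Q))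
    ?_ ?_ ?_ f
  · intro A B ψ
    refine (ofDiff_comp ((ψ ▷ P.as) ▷ Q.as) (α_ B P.as Q.as).hom).symm.trans ?_
    refine Eq.trans ?_ (ofDiff_comp (α_ A P.as Q.as).hom (ψ ▷ (P.as ⊗ Q.as)))
    simp
  · intro A B W
    refine (sound (.assoc W (.cyl P.as) (.cyl Q.as))).trans ?_
    change ofDiff _ ≫ ofCob _ = _
    rw [ofCob_sum, ofCob_cyl_sum, wL_id, Category.comp_id]
    rfl
  · intro _ _ _ f g hf hg
    rw [comp_wR, comp_wR, comp_wR, Category.assoc, hg, ← Category.assoc, hf, Category.assoc]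

theorem assoc_mid {A B : HCobord n X} (f : A ⟶ B) (P Q : HCobord n X) :
    (P ◁ f) ▷ Q ≫ (α_ P B Q).hom = (α_ P A Q).hom ≫ P ◁ (f ▷ Q) := by
  refine ind (P := fun {A B} f => (P ◁ f) ▷ Q ≫ (α_ P B Q).hom = (α_ P A Q).hom ≫ P ◁ (f ▷ Q))
    ?_ ?_ ?_ f
  · intro A B ψ
    refine (ofDiff_comp ((P.as ◁ ψ) ▷ Q.as) (α_ P.as B Q.as).hom).symm.trans ?_
    refine Eq.trans ?_ (ofDiff_comp (α_ P.as A Q.as).hom (P.as ◁ (ψ ▷ Q.as)))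
    simp
  · exact fun W => sound (.assoc (.cyl P.as) W (.cyl Q.as))
  · intro _ _ _ f g hf hg
    rw [comp_wL, comp_wR, comp_wR, comp_wL, Category.assoc, hg, ← Category.assoc, hf,
      Category.assoc]

theorem assoc_right {A B : HCobord n X} (f : A ⟶ B) (P Q : HCobord n X) :
    (P ⊗ Q) ◁ f ≫ (α_ P Q B).hom = (α_ P Q A).hom ≫ P ◁ (Q ◁ f) := by
  refine ind (P := fun {A B} f => (P ⊗ Q) ◁ f ≫ (α_ P Q B).hom = (α_ P Q A).hom ≫ P ◁ (Q ◁ f))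
    ?_ ?_ ?_ f
  · intro A B ψ
    refine (ofDiff_comp ((P.as ⊗ Q.as) ◁ ψ) (α_ P.as Q.as B).hom).symm.trans ?_
    refine Eq.trans ?_ (ofDiff_comp (α_ P.as Q.as A).hom (P.as ◁ (Q.as ◁ ψ)))
    simp
  · intro A B W
    refine Eq.trans ?_ (sound (.assoc (.cyl P.as) (.cyl Q.as) W))
    change _ = ofCob _ ≫ ofDiff _
    rw [ofCob_sum, ofCob_cyl_sum, id_wR, Category.id_comp]
    rfl
  · intro _ _ _ f g hf hg
    rw [comp_wL, comp_wL, comp_wL, Category.assoc, hg, ← Category.assoc, hf, Category.assoc]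

/-- The symmetric monoidal structure given by disjoint union. -/
instance : MonoidalCategory (HCobord n X) where
  tensorHom_def _ _ := rfl
  id_tensorHom_id A B := by
    change 𝟙 A ▷ B ≫ A ◁ 𝟙 B = _
    rw [id_wR, wL_id, Category.comp_id]
  tensorHom_comp_tensorHom {A B C A' B' C'} f f' g g' := by
    change (f ▷ A' ≫ B ◁ f') ≫ (g ▷ B' ≫ C ◁ g') = (f ≫ g) ▷ A' ≫ C ◁ (f' ≫ g')
    rw [comp_wR, comp_wL, Category.assoc, ← Category.assoc (B ◁ f'), ← exch]
    simp only [Category.assoc]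
  whiskerLeft_id P A := wL_id A P
  id_whiskerRight A P := id_wR A P
  associator_naturality {A A' A'' B B' B''} f g h := by
    change ((f ▷ A' ≫ B ◁ g) ▷ A'' ≫ (B ⊗ B') ◁ h) ≫ (α_ B B' B'').hom =
      (α_ A A' A'').hom ≫ f ▷ (A' ⊗ A'') ≫ B ◁ (g ▷ A'' ≫ B' ◁ h)
    rw [Category.assoc, assoc_right, comp_wR, comp_wL, ← Category.assoc _ _ (B ◁ g ▷ A'' ≫ _), ← assoc_left]
    simp only [Category.assoc]
    rw [← Category.assoc ((B ◁ g) ▷ A''), assoc_mid, Category.assoc]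
  leftUnitor_naturality {A B} f := by
    refine ind (P := fun {A B} f => 𝟙_ _ ◁ f ≫ (λ_ B).hom = (λ_ A).hom ≫ f) ?_ ?_ ?_ f
    · intro A B ψ
      refine (ofDiff_comp (𝟙_ _ ◁ ψ) (λ_ B).hom).symm.trans ?_
      refine Eq.trans ?_ (ofDiff_comp (λ_ A).hom ψ)
      simp
    · exact fun W => sound (.leftUnit W)
    · intro _ _ _ f g hf hg
      rw [comp_wL, Category.assoc, hg, ← Category.assoc, hf, Category.assoc]
  rightUnitor_naturality {A B} f := by
    refine ind (P := fun {A B} f => f ▷ 𝟙_ _ ≫ (ρ_ B).hom = (ρ_ A).hom ≫ f) ?_ ?_ ?_ f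
    · intro A B ψ
      refine (ofDiff_comp (ψ ▷ 𝟙_ _) (ρ_ B).hom).symm.trans ?_
      refine Eq.trans ?_ (ofDiff_comp (ρ_ A).hom ψ)
      simp
    · exact fun W => sound (.rightUnit W)
    · intro _ _ _ f g hf hg
      rw [comp_wR, Category.assoc, hg, ← Category.assoc, hf, Category.assoc]
  pentagon A B C D := by
    change ofDiff ((α_ A.as B.as C.as).hom ▷ D.as) ≫ ofDiff (α_ A.as (B.as ⊗ C.as) D.as).hom ≫
      ofDiff (A.as ◁ (α_ B.as C.as D.as).hom) =
      ofDiff (α_ (A.as ⊗ B.as) C.as D.as).hom ≫ ofDiff (α_ A.as B.as (C.as ⊗ D.as)).hom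
    simp only [← ofDiff_comp, MonoidalCategory.pentagon]
  triangle A B := by
    change ofDiff (α_ A.as (𝟙_ _) B.as).hom ≫ ofDiff (A.as ◁ (λ_ B.as).hom) =
      ofDiff ((ρ_ A.as).hom ▷ B.as)
    simp only [← ofDiff_comp, MonoidalCategory.triangle]

theorem braid_left {A B : HCobord n X} (f : A ⟶ B) (P : HCobord n X) :
    f ▷ P ≫ (ofIso (β_ B.as P.as)).hom = (ofIso (β_ A.as P.as)).hom ≫ P ◁ f := by
  refine ind (P := fun {A B} f =>
    f ▷ P ≫ (ofIso (β_ B.as P.as)).hom = (ofIso (β_ A.as P.as)).hom ≫ P ◁ f) ?_ ?_ ?_ f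
  · intro A B ψ
    refine (ofDiff_comp (ψ ▷ P.as) (β_ B P.as).hom).symm.trans ?_
    refine Eq.trans ?_ (ofDiff_comp (β_ A P.as).hom (P.as ◁ ψ))
    simp
  · exact fun W => sound (.braid W (.cyl P.as))
  · intro _ _ _ f g hf hg
    rw [comp_wR, comp_wL, Category.assoc, hg, ← Category.assoc, hf, Category.assoc]

theorem braid_right {A B : HCobord n X} (f : A ⟶ B) (P : HCobord n X) :
    P ◁ f ≫ (ofIso (β_ P.as B.as)).hom = (ofIso (β_ P.as A.as)).hom ≫ f ▷ P := by
  refine ind (P := fun {A B} f =>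
    P ◁ f ≫ (ofIso (β_ P.as B.as)).hom = (ofIso (β_ P.as A.as)).hom ≫ f ▷ P) ?_ ?_ ?_ f
  · intro A B ψ
    refine (ofDiff_comp (P.as ◁ ψ) (β_ P.as B).hom).symm.trans ?_
    refine Eq.trans ?_ (ofDiff_comp (β_ P.as A).hom (ψ ▷ P.as))
    simp
  · exact fun W => sound (.braid (.cyl P.as) W)
  · intro _ _ _ f g hf hg
    rw [comp_wR, comp_wL, Category.assoc, hg, ← Category.assoc, hf, Category.assoc]

instance : SymmetricCategory (HCobord n X) where
  braiding A B := ofIso (β_ A.as B.as)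
  braiding_naturality_left f P := braid_left f P
  braiding_naturality_right P _ _ f := braid_right f P
  hexagon_forward A B C := by
    change ofDiff (α_ A.as B.as C.as).hom ≫ ofDiff (β_ A.as (B.as ⊗ C.as)).hom ≫
      ofDiff (α_ B.as C.as A.as).hom = ofDiff ((β_ A.as B.as).hom ▷ C.as) ≫
      ofDiff (α_ B.as A.as C.as).hom ≫ ofDiff (B.as ◁ (β_ A.as C.as).hom)
    simp only [← ofDiff_comp, BraidedCategory.hexagon_forward]
  hexagon_reverse A B C := by
    change ofDiff (α_ A.as B.as C.as).inv ≫ ofDiff (β_ (A.as ⊗ B.as) C.as).hom ≫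
      ofDiff (α_ C.as A.as B.as).inv = ofDiff (A.as ◁ (β_ B.as C.as).hom) ≫
      ofDiff (α_ A.as C.as B.as).inv ≫ ofDiff ((β_ A.as C.as).hom ▷ B.as)
    simp only [← ofDiff_comp, BraidedCategory.hexagon_reverse]
  symmetry A B := by
    change ofDiff (β_ A.as B.as).hom ≫ ofDiff (β_ B.as A.as).hom = _
    rw [← ofDiff_comp, SymmetricCategory.symmetry]; rfl

/-- The functor from `X`-manifolds and `X`-diffeomorphisms to the homotopy cobordism category. -/
def incl (n : ℕ) (X : PtdSpace.{u}) : XMfd n X ⥤ HCobord n X where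
  obj A := ⟨A⟩
  map ψ := ofDiff ψ
  map_comp := ofDiff_comp

instance : (incl n X).Braided :=
  letI : (incl n X).Monoidal := Functor.CoreMonoidal.toMonoidal
    { εIso := Iso.refl _
      μIso _ _ := Iso.refl _
      μIso_hom_natural_left _ _ := by
        simp only [Iso.refl_hom]; exact (Category.comp_id _).trans (Category.id_comp _).symm
      μIso_hom_natural_right _ _ := by
        simp only [Iso.refl_hom]; exact (Category.comp_id _).trans (Category.id_comp _).symm
      associativity A B C := by
        simp only [Iso.refl_hom]
        erw [id_whiskerRight, whiskerLeft_id, Category.id_comp, Category.id_comp,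
          Category.comp_id, Category.comp_id]
        rfl
      left_unitality A := by
        simp only [Iso.refl_hom]
        erw [id_whiskerRight, Category.id_comp, Category.id_comp]
        rfl
      right_unitality A := by
        simp only [Iso.refl_hom]
        erw [whiskerLeft_id, Category.id_comp, Category.id_comp]
        rfl }
  { braided A B := by
      change 𝟙 _ ≫ ofDiff (β_ A B).hom = ofDiff (β_ A B).hom ≫ 𝟙 _
      rw [Category.id_comp, Category.comp_id] }

end HCobord

section Functors

/-- Symmetric monoidal functors: functors with coherent structural isomorphisms
`F A ⊗ F B ≅ F (A ⊗ B)` and `𝟙_ ≅ F 𝟙_`, compatible with the symmetries. -/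
structure SymMonFunctor (C : Type*) [Category* C] [MonoidalCategory C] [SymmetricCategory C]
    (D : Type*) [Category* D] [MonoidalCategory D] [SymmetricCategory D] where
  toFunctor : C ⥤ D
  [braided : toFunctor.Braided]

attribute [instance] SymMonFunctor.braided

namespace SymMonFunctor

variable {B : Type*} [Category* B] [MonoidalCategory B] [SymmetricCategory B]
  {C : Type*} [Category* C] [MonoidalCategory C] [SymmetricCategory C]
  {D : Type*} [Category* D] [MonoidalCategory D] [SymmetricCategory D]
  {E : Type*} [Category* E] [MonoidalCategory E] [SymmetricCategory E]

/-- The morphisms are the monoidal natural transformations. -/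
@[ext]
structure Hom (F G : SymMonFunctor C D) where
  trans : F.toFunctor ⟶ G.toFunctor
  [mon : trans.IsMonoidal]

attribute [instance] Hom.mon

/-- The category of symmetric monoidal functors. -/
instance : Category (SymMonFunctor C D) where
  Hom := Hom
  id _ := ⟨𝟙 _⟩
  comp α β := ⟨α.trans ≫ β.trans⟩

/-- Composition with a symmetric monoidal functor `G : B ⥤ C`. -/
def precomp (G : B ⥤ C) [G.Braided] : SymMonFunctor C D ⥤ SymMonFunctor B D where
  obj F := ⟨G ⋙ F.toFunctor⟩
  map α := ⟨Functor.whiskerLeft G α.trans⟩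
  map_id _ := rfl
  map_comp _ _ := rfl

/-- Composition with a symmetric monoidal functor `T : D ⥤ E`. -/
def postcomp (T : D ⥤ E) [T.Braided] : SymMonFunctor C D ⥤ SymMonFunctor C E where
  obj F := ⟨F.toFunctor ⋙ T⟩
  map α := ⟨Functor.whiskerRight α.trans T⟩
  map_id _ := Hom.ext (Functor.whiskerRight_id T)
  map_comp α β := Hom.ext (Functor.whiskerRight_comp α.trans β.trans T)

end SymMonFunctor

/-- The category `Mod(R)` of finitely generated free `R`-modules, with the tensor product. -/
abbrev FreeMod (R : Type v) [CommRing R] :=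
  ObjectProperty.FullSubcategory
    (fun M : ModuleCat.{v} R => Module.Free R M ∧ Module.Finite R M)

instance (R : Type v) [CommRing R] : ObjectProperty.IsMonoidal
    (fun M : ModuleCat.{v} R => Module.Free R M ∧ Module.Finite R M) where
  prop_unit := ⟨inferInstanceAs (Module.Free R R), inferInstanceAs (Module.Finite R R)⟩
  prop_tensor M N hM hN := by
    have := hM.1
    have := hM.2
    have := hN.1
    have := hN.2
    exact ⟨inferInstanceAs (Module.Free R (TensorProduct R M N)),
      inferInstanceAs (Module.Finite R (TensorProduct R M N))⟩

end Functors

open Functor.LaxMonoidal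

section Theories

variable {n : ℕ} {X : PtdSpace.{u}} {D : Type*} [Category* D] [MonoidalCategory D]
  [SymmetricCategory D]

/-- An `n`-dimensional homotopy quantum field theory with target `X` and values in a symmetric
monoidal category `D` (the category of finitely generated free modules, for instance): a symmetric
monoidal functor on the category of `X`-manifolds and `X`-diffeomorphisms and, for every
`X`-cobordism, a morphism between the values at its boundaries, such that: gluings are sent to
composites; identity cobordisms to identities; the structural isomorphisms are natural for
cobordisms as well, including the empty cobordism for the unit; and `X`-diffeomorphisms of
`X`-cobordisms give commutative squares. -/
structure HQFT (n : ℕ) (X : PtdSpace.{u}) (D : Type*) [Category* D] [MonoidalCategory D]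
    [SymmetricCategory D] where
  F : XMfd n X ⥤ D
  [braided : F.Braided]
  cob : ∀ {A B : XMfd n X}, XCob A B → (F.obj A ⟶ F.obj B)
  cob_glue : ∀ {A B B' C : XMfd n X} {W : XCob A B} {ψ : B ⟶ B'} {V : XCob B' C} {Q : XCob A C},
    Gluing W ψ V Q → cob Q = cob W ≫ F.map ψ ≫ cob V
  cob_cyl : ∀ A : XMfd n X, cob (.cyl A) = 𝟙 (F.obj A)
  cob_sum : ∀ {A B A' B' : XMfd n X} (W : XCob A B) (V : XCob A' B'),
    μ F A A' ≫ cob (W.sum V) = (cob W ⊗ₘ cob V) ≫ μ F B B'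
  cob_empty : ∀ P : XCob (𝟙_ (XMfd n X)) (𝟙_ (XMfd n X)), IsEmpty P.W.carrier →
    ε F ≫ cob P = ε F
  cob_diffeo : ∀ {A B A' B' : XMfd n X} {W : XCob A B} {V : XCob A' B'} (Ψ : CobDiffeo W V),
    cob W ≫ F.map Ψ.out = F.map Ψ.inn ≫ cob V

attribute [instance] HQFT.braided

namespace HQFT

/-- Maps of HQFTs: monoidal natural transformations that are natural for cobordisms as well. -/
@[ext]
structure Hom (τ ρ : HQFT n X D) where
  trans : τ.F ⟶ ρ.F
  [mon : trans.IsMonoidal]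
  cob : ∀ {A B : XMfd n X} (W : XCob A B), τ.cob W ≫ trans.app B = trans.app A ≫ ρ.cob W

attribute [instance] Hom.mon

/-- The category of HQFTs. -/
instance : Category (HQFT n X D) where
  Hom := Hom
  id _ := { trans := 𝟙 _, cob := by simp }
  comp α β :=
    { trans := α.trans ≫ β.trans
      cob := fun W => by
        rw [NatTrans.comp_app, NatTrans.comp_app, ← Category.assoc, α.cob, Category.assoc, β.cob,
          Category.assoc] }

theorem map_empty (τ : HQFT n X D) {A B : XMfd n X} (a : 𝟙_ (XMfd n X) ⟶ A)
    (b : 𝟙_ (XMfd n X) ⟶ B) (P : XCob A B) (h : IsEmpty P.W.carrier) :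
    τ.F.map a ≫ τ.cob P = τ.F.map b := by
  have : IsEmpty (XCob.cyl (𝟙_ (XMfd n X))).W.carrier :=
    ⟨fun p => isEmptyElim (α := (XMfd.empty n X).M.carrier) p.2⟩
  have := τ.cob_diffeo (CobDiffeo.ofEmpty (XCob.cyl (𝟙_ (XMfd n X))) P a b)
  rw [τ.cob_cyl, Category.id_comp] at this
  exact this.symm

/-- Composition with a symmetric monoidal functor of the values. -/
def postcomp {E : Type*} [Category* E] [MonoidalCategory E] [SymmetricCategory E] (T : D ⥤ E)
    [T.Braided] : HQFT n X D ⥤ HQFT n X E where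
  obj τ :=
    { F := τ.F ⋙ T
      cob := fun W => T.map (τ.cob W)
      cob_glue := fun h => by simp [τ.cob_glue h]
      cob_cyl := fun A => by simp [τ.cob_cyl]
      cob_sum := fun {A B A' B'} W V => by
        rw [Functor.LaxMonoidal.comp_μ, Functor.LaxMonoidal.comp_μ, Category.assoc, ← T.map_comp,
          τ.cob_sum, T.map_comp]
        simp
      cob_empty := fun P hP => by
        rw [Functor.LaxMonoidal.comp_ε, Category.assoc, ← T.map_comp, τ.cob_empty P hP]
      cob_diffeo := fun Ψ => by
        rw [Functor.comp_map, Functor.comp_map, ← T.map_comp, ← T.map_comp, τ.cob_diffeo] }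
  map α :=
    { trans := Functor.whiskerRight α.trans T
      cob := fun W => by
        rw [Functor.whiskerRight_app, Functor.whiskerRight_app, ← T.map_comp, α.cob, T.map_comp] }
  map_id _ := Hom.ext (Functor.whiskerRight_id T)
  map_comp α β := Hom.ext (Functor.whiskerRight_comp α.trans β.trans T)

/-- Change of the target along a map `X ⟶ Y`. -/
def pullback {Y : PtdSpace.{u}} (f : PtdMap X Y) : HQFT n Y D ⥤ HQFT n X D where
  obj τ :=
    { F := pushFunctor f ⋙ τ.F
      cob := fun W => τ.cob (W.push f)
      cob_glue := fun h => τ.cob_glue (h.push f)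
      cob_cyl := fun A => τ.cob_cyl (A.push f)
      cob_sum := fun {A B A' B'} W V => by
        have h := τ.cob_diffeo (CobDiffeo.pushSum f W V)
        have h' := τ.cob_sum (W.push f) (V.push f)
        rw [Functor.LaxMonoidal.comp_μ, Functor.LaxMonoidal.comp_μ, Category.assoc]
        exact (congrArg (μ τ.F _ _ ≫ ·) h.symm).trans
          ((Category.assoc _ _ _).symm.trans ((congrArg (· ≫ _) h').trans (Category.assoc _ _ _)))
      cob_empty := fun P hP => by
        rw [Functor.LaxMonoidal.comp_ε, Category.assoc]
        exact congrArg (ε τ.F ≫ ·) (τ.map_empty _ _ (P.push f) hP)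
      cob_diffeo := fun Ψ => τ.cob_diffeo (Ψ.push f) }
  map α :=
    { trans := Functor.whiskerLeft (pushFunctor f) α.trans
      cob := fun W => α.cob (W.push f) }
  map_id _ := rfl
  map_comp _ _ := rfl

end HQFT
end Theories

section Lift

variable {n : ℕ} {X : PtdSpace.{u}} {D : Type*} [Category* D] [MonoidalCategory D]
  [SymmetricCategory D]

/-- The canonical HQFT with values in the homotopy cobordism category: an `X`-manifold is sent to
itself, an `X`-diffeomorphism and an `X`-cobordism to their classes. -/
def HQFT.canonical (n : ℕ) (X : PtdSpace.{u}) : HQFT n X (HCobord n X) where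
  F := HCobord.incl n X
  cob W := HCobord.ofCob W
  cob_glue h := (HCobord.sound (.glue_along h)).symm
  cob_cyl A := HCobord.ofCob_cyl A
  cob_sum {A B A' B'} W V := by
    change 𝟙 _ ≫ HCobord.ofCob (W.sum V) =
      (HCobord.ofCob W ▷ ⟨A'⟩ ≫ (⟨B⟩ : HCobord n X) ◁ HCobord.ofCob V) ≫ 𝟙 _
    rw [Category.id_comp, Category.comp_id, HCobord.ofCob_sum]
  cob_empty P hP := by
    have : IsEmpty (XCob.cyl (𝟙_ (XMfd n X))).W.carrier :=
      ⟨fun p => isEmptyElim (α := (XMfd.empty n X).M.carrier) p.2⟩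
    have h := HCobord.sound (.cobDiffeo (CobDiffeo.ofEmpty (XCob.cyl (𝟙_ (XMfd n X))) P (𝟙 _) (𝟙 _)))
    change HCobord.ofCob (.cyl _) ≫ 𝟙 _ = 𝟙 _ ≫ HCobord.ofCob P at h
    rw [HCobord.ofCob_cyl, Category.id_comp, Category.id_comp] at h
    change 𝟙 _ ≫ HCobord.ofCob P = 𝟙 _
    rw [← h, Category.id_comp]
  cob_diffeo Ψ := HCobord.sound (.cobDiffeo Ψ)

namespace HQFT

variable (τ : HQFT n X D)

/-- The value of an HQFT on an edge. -/
def evalGen {A B : XMfd n X} : Gen A B → (τ.F.obj A ⟶ τ.F.obj B)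
  | .diff ψ => τ.F.map ψ
  | .cob W => τ.cob W

/-- The value of an HQFT on a string. -/
def eval : {A B : XMfd n X} → Str A B → (τ.F.obj A ⟶ τ.F.obj B)
  | _, _, .gen a => τ.evalGen a
  | _, _, .cons a s => τ.evalGen a ≫ eval s

theorem eval_append : {A B C : XMfd n X} → (s : Str A B) → (t : Str B C) →
    τ.eval (s.append t) = τ.eval s ≫ τ.eval t
  | _, _, _, .gen _, _ => rfl
  | _, _, _, .cons a s, t =>
    (congrArg (τ.evalGen a ≫ ·) (eval_append s t)).trans (Category.assoc _ _ _).symm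

theorem evalGen_wR (P : XMfd n X) {A B : XMfd n X} (a : Gen A B) :
    μ τ.F A P ≫ τ.evalGen (a.whiskerRight P) = τ.evalGen a ▷ τ.F.obj P ≫ μ τ.F B P := by
  cases a with
  | diff ψ => exact (μ_natural_left τ.F ψ P).symm
  | cob W => exact (τ.cob_sum W (.cyl P)).trans (by rw [τ.cob_cyl, tensorHom_id]; rfl)

theorem evalGen_wL (P : XMfd n X) {A B : XMfd n X} (a : Gen A B) :
    μ τ.F P A ≫ τ.evalGen (a.whiskerLeft P) = τ.F.obj P ◁ τ.evalGen a ≫ μ τ.F P B := by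
  cases a with
  | diff ψ => exact (μ_natural_right τ.F P ψ).symm
  | cob W => exact (τ.cob_sum (.cyl P) W).trans (by rw [τ.cob_cyl, id_tensorHom]; rfl)

theorem eval_wR : (P : XMfd n X) → {A B : XMfd n X} → (s : Str A B) →
    μ τ.F A P ≫ τ.eval (s.whiskerRight P) = τ.eval s ▷ τ.F.obj P ≫ μ τ.F B P
  | P, _, _, .gen a => τ.evalGen_wR P a
  | P, _, _, .cons a s => by
    simp only [Str.whiskerRight, eval]
    rw [← Category.assoc, evalGen_wR, Category.assoc, eval_wR _ s, comp_whiskerRight,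
      Category.assoc]

theorem eval_wL : (P : XMfd n X) → {A B : XMfd n X} → (s : Str A B) →
    μ τ.F P A ≫ τ.eval (s.whiskerLeft P) = τ.F.obj P ◁ τ.eval s ≫ μ τ.F P B
  | P, _, _, .gen a => τ.evalGen_wL P a
  | P, _, _, .cons a s => by
    simp only [Str.whiskerLeft, eval]
    rw [← Category.assoc, evalGen_wL, Category.assoc, eval_wL _ s, MonoidalCategory.whiskerLeft_comp,
      Category.assoc]

theorem eval_rel {A B : XMfd n X} {s t : Str A B} (h : Rel s t) : τ.eval s = τ.eval t := by
  induction h with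
  | refl => rfl
  | symm _ h => exact h.symm
  | trans _ _ h h' => exact h.trans h'
  | append _ _ h h' => rw [eval_append, eval_append, h, h']
  | whiskerRight P _ h => rw [← cancel_epi (μ τ.F _ P), eval_wR, eval_wR, h]
  | whiskerLeft P _ h => rw [← cancel_epi (μ τ.F P _), eval_wL, eval_wL, h]
  | diff_comp ψ φ => exact (τ.F.map_comp ψ φ).symm
  | glue h => exact (by simp [τ.cob_glue h, eval, evalGen, Str.append])
  | cyl A => exact (τ.cob_cyl A).trans (τ.F.map_id A).symm
  | @exchange A B A' B' a b =>
    rw [← cancel_epi (μ τ.F _ _)]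
    simp only [Str.append, eval]
    rw [← Category.assoc, ← Category.assoc, evalGen_wR, evalGen_wL, Category.assoc, Category.assoc,
      evalGen_wL, evalGen_wR, ← Category.assoc, ← Category.assoc, whisker_exchange]
  | @sum_cob A B A' B' W V =>
    rw [← cancel_epi (μ τ.F _ _)]
    simp only [Str.append, eval, evalGen]
    rw [← Category.assoc, τ.cob_sum, τ.cob_sum, Category.assoc, τ.cob_sum, τ.cob_cyl, τ.cob_cyl,
      MonoidalCategory.tensorHom_def, tensorHom_id, id_tensorHom, Category.assoc]
  | @assoc A B A' B' A'' B'' W V U =>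
    rw [← cancel_epi (μ τ.F (A ⊗ A') A''), ← cancel_epi (μ τ.F A A' ▷ τ.F.obj A'')]
    simp only [Str.append, eval, evalGen]
    calc μ τ.F A A' ▷ τ.F.obj A'' ≫ μ τ.F (A ⊗ A') A'' ≫ τ.cob ((W.sum V).sum U) ≫
          τ.F.map (α_ B B' B'').hom
        = (μ τ.F A A' ▷ τ.F.obj A'' ≫ (τ.cob (W.sum V) ⊗ₘ τ.cob U)) ≫
          μ τ.F (B ⊗ B') B'' ≫ τ.F.map (α_ B B' B'').hom := by
          rw [← Category.assoc (μ τ.F (A ⊗ A') A''), τ.cob_sum]; simp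
      _ = ((τ.cob W ⊗ₘ τ.cob V) ⊗ₘ τ.cob U) ≫ μ τ.F B B' ▷ τ.F.obj B'' ≫
          μ τ.F (B ⊗ B') B'' ≫ τ.F.map (α_ B B' B'').hom := by
          rw [whiskerRight_comp_tensorHom, τ.cob_sum, ← tensorHom_comp_whiskerRight, Category.assoc]
      _ = (α_ _ _ _).hom ≫ (τ.cob W ⊗ₘ τ.cob V ⊗ₘ τ.cob U) ≫ τ.F.obj B ◁ μ τ.F B' B'' ≫
          μ τ.F B (B' ⊗ B'') := by
          rw [Functor.LaxMonoidal.associativity, associator_naturality_assoc]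
      _ = (α_ _ _ _).hom ≫ τ.F.obj A ◁ μ τ.F A' A'' ≫ (τ.cob W ⊗ₘ τ.cob (V.sum U)) ≫
          μ τ.F B (B' ⊗ B'') := by
          rw [← Category.assoc (τ.F.obj A ◁ _), whiskerLeft_comp_tensorHom, τ.cob_sum,
            ← tensorHom_comp_whiskerLeft, Category.assoc]
      _ = _ := by
          rw [← τ.cob_sum, ← Functor.LaxMonoidal.associativity_assoc]
  | @leftUnit A B W =>
    rw [← cancel_epi (μ τ.F (𝟙_ _) A), ← cancel_epi (ε τ.F ▷ τ.F.obj A)]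
    simp only [Str.append, eval, evalGen]
    rw [← Category.assoc (μ τ.F (𝟙_ _) A), τ.cob_sum, τ.cob_cyl, id_tensorHom, Category.assoc,
      ← whisker_exchange_assoc, ← Functor.LaxMonoidal.left_unitality, leftUnitor_naturality,
      Functor.LaxMonoidal.left_unitality, Category.assoc, Category.assoc]
  | @rightUnit A B W =>
    rw [← cancel_epi (μ τ.F A (𝟙_ _)), ← cancel_epi (τ.F.obj A ◁ ε τ.F)]
    simp only [Str.append, eval, evalGen]
    rw [← Category.assoc (μ τ.F A (𝟙_ _)), τ.cob_sum, τ.cob_cyl, tensorHom_id, Category.assoc,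
      whisker_exchange_assoc, ← Functor.LaxMonoidal.right_unitality, rightUnitor_naturality,
      Functor.LaxMonoidal.right_unitality, Category.assoc, Category.assoc]
  | @braid A B A' B' W V =>
    rw [← cancel_epi (μ τ.F A A')]
    simp only [Str.append, eval, evalGen]
    rw [← Category.assoc, τ.cob_sum, Category.assoc, Functor.LaxBraided.braided,
      BraidedCategory.braiding_naturality_assoc, ← τ.cob_sum, Functor.LaxBraided.braided_assoc]
  | cobDiffeo Ψ => exact τ.cob_diffeo Ψ
  | glue_along h => exact (τ.cob_glue h).symm
  | cob_cyl W => exact (congrArg (τ.cob W ≫ ·) (τ.cob_cyl _)).trans (Category.comp_id _)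
  | cyl_cob W => exact (congrArg (· ≫ τ.cob W) (τ.cob_cyl _)).trans (Category.id_comp _)

/-- The functor on the homotopy cobordism category induced by an HQFT. -/
def lift : HCobord n X ⥤ D where
  obj A := τ.F.obj A.as
  map := Quotient.lift τ.eval fun _ _ h => τ.eval_rel h
  map_id A := τ.F.map_id A.as
  map_comp := by rintro _ _ _ ⟨s⟩ ⟨t⟩; exact τ.eval_append s t

instance : τ.lift.Braided :=
  letI : τ.lift.Monoidal := Functor.CoreMonoidal.toMonoidal
    { εIso := Functor.Monoidal.εIso τ.F
      μIso A B := Functor.Monoidal.μIso τ.F A.as B.as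
      μIso_hom_natural_left := by rintro _ _ ⟨s⟩ P; exact (τ.eval_wR P.as s).symm
      μIso_hom_natural_right := by rintro _ _ P ⟨s⟩; exact (τ.eval_wL P.as s).symm
      associativity A B C := Functor.LaxMonoidal.associativity τ.F A.as B.as C.as
      left_unitality A := Functor.LaxMonoidal.left_unitality τ.F A.as
      right_unitality A := Functor.LaxMonoidal.right_unitality τ.F A.as }
  { braided A B := Functor.LaxBraided.braided (F := τ.F) A.as B.as }

end HQFT

/-- The functor of homotopy cobordism categories induced by a map `f : X ⟶ Y`: it composes
characteristic maps and homotopy classes with `f`. -/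
def HCobord.push {Y : PtdSpace.{u}} (f : PtdMap X Y) : HCobord n X ⥤ HCobord n Y :=
  ((HQFT.pullback f).obj (HQFT.canonical n Y)).lift

instance {Y : PtdSpace.{u}} (f : PtdMap X Y) : (HCobord.push (n := n) f).Braided :=
  inferInstanceAs ((HQFT.pullback f).obj (HQFT.canonical n Y)).lift.Braided

/-- The HQFT underlying a symmetric monoidal functor on the homotopy cobordism category: its
restriction to `X`-manifolds, (classes of) `X`-diffeomorphisms and (classes of) `X`-cobordisms. -/
def SymMonFunctor.restrict (n : ℕ) (X : PtdSpace.{u}) (D : Type*) [Category* D]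
    [MonoidalCategory D] [SymmetricCategory D] :
    SymMonFunctor (HCobord n X) D ⥤ HQFT n X D where
  obj F := (HQFT.postcomp F.toFunctor).obj (HQFT.canonical n X)
  map α :=
    { trans := Functor.whiskerLeft (HCobord.incl n X) α.trans
      mon := NatTrans.IsMonoidal.whiskerLeft (F₁ := HCobord.incl n X) α.trans
      cob := fun W => α.trans.naturality (HCobord.ofCob W) }
  map_id _ := rfl
  map_comp _ _ := rfl

end Lift

end HQFTs

end

open HQFTs

noncomputable section

/-! The homotopy cobordism category is presented by generators and relations, and the HQFT axioms
say exactly that an assignment on the generators respects the relations. The theorem is thus the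
universal property of `HCobord n X`: the assignment `HQFT.canonical`, sending `X`-manifolds,
`X`-diffeomorphisms and `X`-cobordisms to themselves or their classes, is the universal HQFT.

Extension: an HQFT `τ` has a value on every string, the composite of its values on the letters.
`HQFT.eval_rel` shows that equivalent strings have equal values. The gluing, cylinder and
`CobDiffeo` relations come from the axioms with the same content. Compatibility with disjoint union
holds because `μ` intertwines the value of `s ⊔ P` with the value of `s` tensored with the identity;
here `cob_sum` and `cob_cyl` enter together, and `μ` can be cancelled because it is invertible. The
interchange relation becomes interchange in the target category, and naturality of the structural
diffeomorphisms becomes coherence of `μ`, `ε` and the braiding. The result is `HQFT.lift`, which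
keeps the objects and the structural isomorphisms of `τ`.

Restriction: the imposed relations make `HQFT.canonical` an HQFT, and a symmetric monoidal functor
carries HQFTs to HQFTs, so `SymMonFunctor.restrict` composes with the canonical one.

The two constructions are inverse because every morphism is a composite of generators
(`HCobord.ind`): a functor is determined by its values on them, and a transformation is natural as
soon as it is natural for them. The outcome is an isomorphism of categories, and not merely an
equivalence, since both constructions leave objects, values on generators and components of maps
untouched; the structural morphisms change at most by composition with an identity. The same
comparison on generators gives both naturality statements. What remains is to reduce strict equality
of functors with extra structure to equality of such data, which is the work of `braided_ext`, the
two `ext_of_heq` and the two `hom_heq`. -/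

namespace HQFTs

open Functor.LaxMonoidal

/-! ### Strict equality of symmetric monoidal functors, of HQFTs and of their maps. -/

section Extensionality

variable {C : Type*} [Category* C] [MonoidalCategory C] [SymmetricCategory C]
  {D : Type*} [Category* D] [MonoidalCategory D] [SymmetricCategory D]

/-- A braided structure on a functor is determined by its lax structural morphisms. -/
theorem braided_ext {F : C ⥤ D} (b b' : F.Braided)
    (hε : letI := b; letI e := ε F; letI := b'; e = ε F)
    (hμ : ∀ A B, letI := b; letI m := μ F A B; letI := b'; m = μ F A B) : b = b' := by
  obtain @⟨m, _⟩ := b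
  obtain @⟨m', _⟩ := b'
  have hl : m.toLaxMonoidal = m'.toLaxMonoidal :=
    Functor.LaxMonoidal.ext hε (by ext A B; exact hμ A B)
  -- The oplax morphisms are the inverses of `ε` and `μ`, and equal isomorphisms have equal
  -- inverses.
  have ho : m.toOplaxMonoidal = m'.toOplaxMonoidal := by
    refine Functor.OplaxMonoidal.ext ?_ ?_
    · exact congrArg Iso.inv (Iso.ext hε :
        @Functor.Monoidal.εIso _ _ _ _ _ _ F m = @Functor.Monoidal.εIso _ _ _ _ _ _ F m')
    · ext A B
      exact congrArg Iso.inv (Iso.ext (hμ A B) :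
        @Functor.Monoidal.μIso _ _ _ _ _ _ F m A B = @Functor.Monoidal.μIso _ _ _ _ _ _ F m' A B)
  -- Beyond the lax and oplax parts there are only propositions, so identifying those two parts
  -- identifies the structures.
  obtain ⟨⟩ := m
  obtain ⟨⟩ := m'
  cases hl
  cases ho
  rfl

/-- Equality of functors on the nose has to compare morphisms whose types agree only through `hobj`,
hence the heterogeneous equalities. Once the underlying functors are identified these become
ordinary equalities, and `braided_ext` concludes. In every application below the objects agree by
definition. -/
theorem SymMonFunctor.ext_of_heq {F G : SymMonFunctor C D}
    (hobj : ∀ A, F.toFunctor.obj A = G.toFunctor.obj A)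
    (hmap : ∀ {A B : C} (f : A ⟶ B), F.toFunctor.map f ≍ G.toFunctor.map f)
    (hε : ε F.toFunctor ≍ ε G.toFunctor)
    (hμ : ∀ A B, μ F.toFunctor A B ≍ μ G.toFunctor A B) : F = G := by
  obtain @⟨F, b⟩ := F
  obtain @⟨G, b'⟩ := G
  obtain rfl : F = G := Functor.hext hobj fun _ _ f => hmap f
  rw [braided_ext b b' (eq_of_heq hε) fun A B => eq_of_heq (hμ A B)]

/-- This supplies the morphism part of `Functor.hext`, where the two transformations have sources
and targets that are equal without being the same expression. Monoidality is a proposition, so the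
components decide. -/
theorem SymMonFunctor.hom_heq {F G F' G' : SymMonFunctor C D} (hF : F = F') (hG : G = G')
    {α : F ⟶ G} {β : F' ⟶ G'} (h : ∀ A, α.trans.app A ≍ β.trans.app A) : α ≍ β := by
  subst hF hG
  exact heq_of_eq (SymMonFunctor.Hom.ext (NatTrans.ext (funext fun A => eq_of_heq (h A))))

variable {n : ℕ} {X : PtdSpace.{u}}

/-- The data are a functor, a braided structure on it and values on cobordisms; they are identified
in this order because each lives over the previous ones. The axioms are propositions. -/
theorem HQFT.ext_of_heq {τ ρ : HQFT n X D} (hobj : ∀ A, τ.F.obj A = ρ.F.obj A)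
    (hmap : ∀ {A B : XMfd n X} (f : A ⟶ B), τ.F.map f ≍ ρ.F.map f)
    (hε : ε τ.F ≍ ε ρ.F) (hμ : ∀ A B, μ τ.F A B ≍ μ ρ.F A B)
    (hcob : ∀ {A B : XMfd n X} (W : XCob A B), τ.cob W ≍ ρ.cob W) : τ = ρ := by
  obtain @⟨F, b, cob⟩ := τ
  obtain @⟨G, b', cob'⟩ := ρ
  obtain rfl : F = G := Functor.hext hobj fun _ _ f => hmap f
  obtain rfl : b = b' := braided_ext b b' (eq_of_heq hε) fun A B => eq_of_heq (hμ A B)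
  obtain rfl : @cob = @cob' := by
    funext A B W
    exact eq_of_heq (hcob W)
  rfl

theorem HQFT.hom_heq {τ ρ τ' ρ' : HQFT n X D} (hτ : τ = τ') (hρ : ρ = ρ')
    {α : τ ⟶ ρ} {β : τ' ⟶ ρ'} (h : ∀ A, α.trans.app A ≍ β.trans.app A) : α ≍ β := by
  subst hτ hρ
  exact heq_of_eq (HQFT.Hom.ext (NatTrans.ext (funext fun A => eq_of_heq (h A))))

end Extensionality

/-! ### Extension of HQFTs and of their maps to the homotopy cobordism category. -/

section Equivalence

/-- Naturality squares paste along composition, and every morphism is a composite of generators. The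
two hypotheses match the two naturality conditions on a map of HQFTs. -/
theorem HCobord.naturality_of_generators {n : ℕ} {X : PtdSpace.{u}} {D : Type*} [Category* D]
    {F G : HCobord n X ⥤ D}
    (app : ∀ A, F.obj A ⟶ G.obj A)
    (diff : ∀ {A B : XMfd n X} (ψ : A ⟶ B),
      F.map (HCobord.ofDiff ψ) ≫ app ⟨B⟩ = app ⟨A⟩ ≫ G.map (HCobord.ofDiff ψ))
    (cob : ∀ {A B : XMfd n X} (W : XCob A B),
      F.map (HCobord.ofCob W) ≫ app ⟨B⟩ = app ⟨A⟩ ≫ G.map (HCobord.ofCob W))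
    {A B : HCobord n X} (f : A ⟶ B) : F.map f ≫ app B = app A ≫ G.map f := by
  refine HCobord.ind (P := fun {A B} f => F.map f ≫ app B = app A ≫ G.map f) diff cob ?_ f
  intro _ _ _ f g hf hg
  rw [F.map_comp, G.map_comp, Category.assoc, hg, ← Category.assoc, hf, Category.assoc]

variable {n : ℕ} {X : PtdSpace.{u}} {D : Type*} [Category* D] [MonoidalCategory D]
  [SymmetricCategory D]

/-- The transformation of functors on the homotopy cobordism category induced by a map of HQFTs. -/
def HQFT.Hom.lift {τ ρ : HQFT n X D} (α : HQFT.Hom τ ρ) : τ.lift ⟶ ρ.lift where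
  app A := α.trans.app A.as
  naturality _ _ f :=
    HCobord.naturality_of_generators (F := τ.lift) (G := ρ.lift) (fun A => α.trans.app A.as)
      (fun ψ => α.trans.naturality ψ) (fun W => α.cob W) f

/-- The structural isomorphisms of `τ.lift` are those of `τ.F`, and the components of `α.lift` are
those of `α`, so the conditions are literally the ones `α` satisfies. -/
instance {τ ρ : HQFT n X D} (α : HQFT.Hom τ ρ) : α.lift.IsMonoidal where
  unit := α.mon.unit
  tensor A B := α.mon.tensor A.as B.as

variable (n X D) in
/-- The functor extending HQFTs to the homotopy cobordism category. -/
def HQFT.extend : HQFT n X D ⥤ SymMonFunctor (HCobord n X) D where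
  obj τ := ⟨τ.lift⟩
  map α := ⟨α.lift⟩
  map_id _ := rfl
  map_comp _ _ := rfl

/-! ### Extension and restriction are mutually inverse. -/

theorem HQFT.restrict_extend_obj (τ : HQFT n X D) :
    (SymMonFunctor.restrict n X D).obj ((HQFT.extend n X D).obj τ) = τ := by
  refine HQFT.ext_of_heq (fun _ => rfl) (fun _ => HEq.rfl) (heq_of_eq ?_)
    (fun A B => heq_of_eq ?_) (fun _ => HEq.rfl)
  -- Restriction composes with `HCobord.incl`, whose structural isomorphisms are identities; each of
  -- `ε` and `μ` therefore picks up the image of an identity as an extra factor.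
  · exact (congrArg (ε τ.F ≫ ·) (τ.F.map_id _)).trans (Category.comp_id _)
  · exact (congrArg (μ τ.F A B ≫ ·) (τ.F.map_id _)).trans (Category.comp_id _)

/-- This is the uniqueness half of the universal property. On a generator both sides are the same by
definition; on a longer string the lift is a composite of values of `F`, which is where
functoriality of `F` is needed. -/
theorem HQFT.lift_map_restrict (F : SymMonFunctor (HCobord n X) D) {A B : HCobord n X}
    (f : A ⟶ B) :
    ((SymMonFunctor.restrict n X D).obj F).lift.map f = F.toFunctor.map f := by
  refine HCobord.ind (P := fun {A B} f =>
    ((SymMonFunctor.restrict n X D).obj F).lift.map f = F.toFunctor.map f) ?_ ?_ ?_ f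
  · exact fun _ => rfl
  · exact fun _ => rfl
  · intro _ _ _ f g hf hg
    rw [Functor.map_comp, hf, hg]
    exact (F.toFunctor.map_comp f g).symm

theorem HQFT.extend_restrict_obj (F : SymMonFunctor (HCobord n X) D) :
    (HQFT.extend n X D).obj ((SymMonFunctor.restrict n X D).obj F) = F := by
  refine SymMonFunctor.ext_of_heq (fun _ => rfl)
    (fun f => heq_of_eq (HQFT.lift_map_restrict F f)) (heq_of_eq ?_) (fun A B => heq_of_eq ?_)
  · exact (congrArg (ε F.toFunctor ≫ ·) (F.toFunctor.map_id _)).trans (Category.comp_id _)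
  · exact (congrArg (μ F.toFunctor A B ≫ ·) (F.toFunctor.map_id _)).trans (Category.comp_id _)

/-- On maps there is nothing to compute, as neither functor alters a component; the heterogeneous
equality only absorbs the change of source and target. The other functor identities below follow the
same pattern. -/
theorem HQFT.extend_comp_restrict :
    HQFT.extend n X D ⋙ SymMonFunctor.restrict n X D = 𝟭 _ :=
  Functor.hext HQFT.restrict_extend_obj fun τ ρ _ =>
    HQFT.hom_heq τ.restrict_extend_obj ρ.restrict_extend_obj fun _ => HEq.rfl

theorem HQFT.restrict_comp_extend :
    SymMonFunctor.restrict n X D ⋙ HQFT.extend n X D = 𝟭 _ :=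
  Functor.hext HQFT.extend_restrict_obj fun F G _ =>
    SymMonFunctor.hom_heq (HQFT.extend_restrict_obj F) (HQFT.extend_restrict_obj G)
      fun _ => HEq.rfl

/-! ### Naturality in the target space. -/

/-- Since `HCobord.push f` is itself the lift of the pulled-back canonical HQFT, both sides send a
generator to the value of `τ` at that generator composed with `f`. -/
theorem HQFT.lift_map_pullback {Y : PtdSpace.{u}} (f : PtdMap X Y) (τ : HQFT n Y D)
    {A B : HCobord n X} (g : A ⟶ B) :
    ((HQFT.pullback f).obj τ).lift.map g = τ.lift.map ((HCobord.push f).map g) := by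
  refine HCobord.ind (P := fun {A B} g =>
    ((HQFT.pullback f).obj τ).lift.map g = τ.lift.map ((HCobord.push f).map g)) ?_ ?_ ?_ g
  · exact fun _ => rfl
  · exact fun _ => rfl
  · intro _ _ _ g h hg hh
    rw [Functor.map_comp, hg, hh, Functor.map_comp]
    exact (τ.lift.map_comp _ _).symm

theorem HQFT.extend_pullback_obj {Y : PtdSpace.{u}} (f : PtdMap X Y) (τ : HQFT n Y D) :
    (HQFT.extend n X D).obj ((HQFT.pullback f).obj τ) =
      (SymMonFunctor.precomp (HCobord.push f)).obj ((HQFT.extend n Y D).obj τ) := by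
  refine SymMonFunctor.ext_of_heq (fun _ => rfl)
    (fun g => heq_of_eq (HQFT.lift_map_pullback f τ g)) (heq_of_eq ?_) (fun A B => heq_of_eq ?_)
  -- The unit morphism of `HCobord.push f` is that of `pushFunctor f ⋙ HCobord.incl n Y`: an
  -- identity followed by the class of the diffeomorphism `ε (pushFunctor f)`. Removing the identity
  -- leaves the unit morphism of the pulled-back theory; `μ` is treated alike.
  · exact congrArg (fun k => ε τ.F ≫ τ.lift.map k)
      (Category.id_comp (HCobord.ofDiff (ε (pushFunctor (n := n) f)))).symm
  · exact congrArg (fun k => μ τ.F _ _ ≫ τ.lift.map k)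
      (Category.id_comp (HCobord.ofDiff (μ (pushFunctor (n := n) f) A.as B.as))).symm

theorem HQFT.pullback_comp_extend {Y : PtdSpace.{u}} (f : PtdMap X Y) :
    HQFT.pullback f ⋙ HQFT.extend n X D =
      HQFT.extend n Y D ⋙ SymMonFunctor.precomp (HCobord.push f) :=
  Functor.hext (HQFT.extend_pullback_obj f) fun τ ρ _ =>
    SymMonFunctor.hom_heq (HQFT.extend_pullback_obj f τ) (HQFT.extend_pullback_obj f ρ)
      fun _ => HEq.rfl

/-! ### Naturality in the category of values. -/

variable {E : Type*} [Category* E] [MonoidalCategory E] [SymmetricCategory E]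

theorem HQFT.lift_map_postcomp (T : D ⥤ E) [T.Braided] (τ : HQFT n X D) {A B : HCobord n X}
    (f : A ⟶ B) : ((HQFT.postcomp T).obj τ).lift.map f = T.map (τ.lift.map f) := by
  refine HCobord.ind (P := fun {A B} f =>
    ((HQFT.postcomp T).obj τ).lift.map f = T.map (τ.lift.map f)) ?_ ?_ ?_ f
  · exact fun _ => rfl
  · exact fun _ => rfl
  · intro _ _ _ f g hf hg
    rw [Functor.map_comp, hf, hg, Functor.map_comp]
    exact (T.map_comp _ _).symm

/-- Here the structural morphisms agree by definition: on both sides they are those of `T` followed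
by the images under `T` of those of `τ.F`, with no inclusion functor in between. -/
theorem HQFT.extend_postcomp_obj (T : D ⥤ E) [T.Braided] (τ : HQFT n X D) :
    (HQFT.extend n X E).obj ((HQFT.postcomp T).obj τ) =
      (SymMonFunctor.postcomp T).obj ((HQFT.extend n X D).obj τ) :=
  SymMonFunctor.ext_of_heq (fun _ => rfl)
    (fun f => heq_of_eq (HQFT.lift_map_postcomp T τ f)) HEq.rfl fun _ _ => HEq.rfl

theorem HQFT.postcomp_comp_extend (T : D ⥤ E) [T.Braided] :
    HQFT.postcomp T ⋙ HQFT.extend n X E = HQFT.extend n X D ⋙ SymMonFunctor.postcomp T :=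
  Functor.hext (HQFT.extend_postcomp_obj T) fun τ ρ _ =>
    SymMonFunctor.hom_heq (HQFT.extend_postcomp_obj T τ) (HQFT.extend_postcomp_obj T ρ)
      fun _ => HEq.rfl

end Equivalence

end HQFTs

end

/-- The preceding results hold for values in any symmetric monoidal category; this is their case of
finitely generated free modules, with `HQFT.extend` as the witness for every `X` and `R`. -/
theorem mainTheorem5 (n : ℕ) :
    ∃ Φ : ∀ (X : PtdSpace.{u}) (R : Type v) [CommRing R],
        HQFT n X (FreeMod R) ⥤ SymMonFunctor (HCobord n X) (FreeMod R),
      (∀ (X : PtdSpace.{u}) (R : Type v) [CommRing R],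
        Φ X R ⋙ SymMonFunctor.restrict n X (FreeMod R) = 𝟭 _ ∧
        SymMonFunctor.restrict n X (FreeMod R) ⋙ Φ X R = 𝟭 _) ∧
      (∀ (X Y : PtdSpace.{u}) (f : PtdMap X Y) (R : Type v) [CommRing R],
        HQFT.pullback f ⋙ Φ X R = Φ Y R ⋙ SymMonFunctor.precomp (HCobord.push f)) ∧
      ∀ (X : PtdSpace.{u}) (R S : Type v) [CommRing R] [CommRing S]
        (T : FreeMod R ⥤ FreeMod S) [T.Braided],
        HQFT.postcomp T ⋙ Φ X S = Φ X R ⋙ SymMonFunctor.postcomp T :=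
  ⟨fun X R _ => HQFT.extend n X (FreeMod R),
    fun _ _ _ => ⟨HQFT.extend_comp_restrict, HQFT.restrict_comp_extend⟩,
    fun _ _ f _ _ => HQFT.pullback_comp_extend f,
    fun _ _ _ _ _ T _ => HQFT.postcomp_comp_extend T⟩
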